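/- Let $\mathbb K$ be $\mathbb R$ or $\mathbb C$; all Banach spaces are over $\mathbb K$. A bounded operator $T$ on a Banach space $Z$ is called $\delta$-hypercyclic if there is $x\in Z$ such that for every non-zero $y\in Z$ there is $n\in\mathbb N$ with $\|T^nx-y\|\le\delta\|y\|$. A basis $(e_n)_{n\ge0}$ is $1$-unconditional if $\|\sum_{n=0}^N b_ne_n\|\le\|\sum_{n=0}^N a_ne_n\|$ for all $N\ge 0$ and all scalars with $|b_n|\le|a_n|$, $0\le n\le N$. If $X,Y$ are Banach spaces and $(f_n)_{n\ge0}$ is a $1$-unconditional basis of $Y$, then $\bigoplus_YX$ denotes the space of all sequences $(x_n)_{n\geq 0}$ in $X$ such that $\sum_{n}\|x_n\|f_n$ converges in $Y$, with norm $\|(x_n)\|=\big\|\sum_{n}\|x_n\|f_n\big\|_Y$. A Banach space $Z$ contains a complemented copy of $E$ if some subspace of $Z$ that is the range of a bounded linear projection on $Z$ is linearly homeomorphic to $E$. Corollary. Let $Z$ be a separable Banach space which contains a complemented copy of $\bigoplus_YX$, where $X$ is an infinite-dimensional separable Banach space with a $1$-unconditional basis and $Y$ is an infinite-dimensional separable Banach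 space with a normalized $1$-unconditional basis $(f_n)_{n\ge0}$, used to define $\bigoplus_YX$, whose backward shift $\sum_n y_nf_n\mapsto\sum_n y_{n+1}f_n$ is a continuous operator on $Y$. Then for every $\varepsilon\in(0,1)$ there exists a bounded operator on $Z$ which is not $\delta$-hypercyclic for all $\delta\in(0,\varepsilon)$ and which is $\delta$-hypercyclic for all $\delta\in(\varepsilon,1)$. In particular, if a separable Banach space $Z$ contains a complemented copy of $E=c_0(\mathbb N)$ or of $E=\ell^p(\mathbb N)$ for some $p\in[1,+\infty)$, then $Z$ satisfies these assumptions with $X=Y=E$, and hence the conclusion holds for $Z$. -/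

import Mathlib

open Filter Topology

noncomputable section

section Hypercyclicity

variable {𝕜 : Type*} [RCLike 𝕜] {Z : Type*} [NormedAddCommGroup Z] [NormedSpace 𝕜 Z]

/-- `x` is an `ε`-hypercyclic vector for `T`. -/
def IsEpsHypercyclicVector (T : Z →L[𝕜] Z) (ε : ℝ) (x : Z) : Prop :=
  ∀ y : Z, y ≠ 0 → ∃ n : ℕ, ‖(T ^ n) x - y‖ ≤ ε * ‖y‖

/-- `T` is `ε`-hypercyclic: it admits an `ε`-hypercyclic vector. -/
def IsEpsHypercyclic (T : Z →L[𝕜] Z) (ε : ℝ) : Prop :=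
  ∃ x : Z, IsEpsHypercyclicVector T ε x

end Hypercyclicity

/-- For every `ε ∈ (0,1)` there is a bounded operator on `Z` which is not `δ`-hypercyclic for all
`δ ∈ (0,ε)` and which is `δ`-hypercyclic for all `δ ∈ (ε,1)`. -/
def EveryEpsIsThreshold (𝕜 : Type*) [RCLike 𝕜]
    (Z : Type*) [NormedAddCommGroup Z] [NormedSpace 𝕜 Z] : Prop :=
  ∀ ε ∈ Set.Ioo (0 : ℝ) 1, ∃ T : Z →L[𝕜] Z,
    (∀ δ ∈ Set.Ioo (0 : ℝ) ε, ¬ IsEpsHypercyclic T δ) ∧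
    (∀ δ ∈ Set.Ioo ε 1, IsEpsHypercyclic T δ)

section Bases

variable {𝕜 : Type*} [RCLike 𝕜] {E : Type*} [NormedAddCommGroup E] [NormedSpace 𝕜 E]

/-- The basis `e` is `C`-unconditional. -/
def IsUnconditionalBasis (C : ℝ) (e : SchauderBasis 𝕜 E) : Prop :=
  ∀ (N : ℕ) (a b : ℕ → 𝕜), (∀ n ∈ Finset.range (N + 1), ‖b n‖ ≤ ‖a n‖) →
    ‖∑ n ∈ Finset.range (N + 1), b n • e n‖ ≤ C * ‖∑ n ∈ Finset.range (N + 1), a n • e n‖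

/-- All the vectors of the basis have norm one. -/
def IsNormalizedBasis (e : SchauderBasis 𝕜 E) : Prop := ∀ n, ‖e n‖ = 1

/-- The backward shift `∑ yₙ eₙ ↦ ∑ yₙ₊₁ eₙ` associated with the basis `e` is a well-defined
continuous operator on the space. -/
def HasContinuousBackwardShift (e : SchauderBasis 𝕜 E) : Prop :=
  ∃ B : E →L[𝕜] E, B (e 0) = 0 ∧ ∀ n, B (e (n + 1)) = e n

/-- Comparison of finite sums over arbitrary finite sets of indices. -/
theorem IsUnconditionalBasis.norm_sum_le {e : SchauderBasis 𝕜 E} (he : IsUnconditionalBasis 1 e)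
    (s : Finset ℕ) (a b : ℕ → 𝕜) (h : ∀ n ∈ s, ‖b n‖ ≤ ‖a n‖) :
    ‖∑ n ∈ s, b n • e n‖ ≤ ‖∑ n ∈ s, a n • e n‖ := by
  have hs : s ⊆ Finset.range (s.sup id + 1) := fun n hn =>
    Finset.mem_range.2 (Nat.lt_succ_of_le (Finset.le_sup (f := id) hn))
  have key : ∀ c : ℕ → 𝕜, ∑ n ∈ Finset.range (s.sup id + 1), (if n ∈ s then c n else 0) • e n
      = ∑ n ∈ s, c n • e n := by
    intro c
    rw [← Finset.sum_subset hs (f := fun n => (if n ∈ s then c n else 0) • e n)]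
    · exact Finset.sum_congr rfl fun n hn => by simp [hn]
    · intro n _ hn
      simp [hn]
  have := he (s.sup id) (fun n => if n ∈ s then a n else 0) (fun n => if n ∈ s then b n else 0)
    (by
      intro n _
      by_cases hn : n ∈ s
      · simpa [hn] using h n hn
      · simp [hn])
  rw [key, key, one_mul] at this
  exact this

/-- Comparison principle: domination of coefficients preserves convergence. -/
theorem IsUnconditionalBasis.summable_of_le [CompleteSpace E] {e : SchauderBasis 𝕜 E}
    (he : IsUnconditionalBasis 1 e) {a b : ℕ → 𝕜} (h : ∀ n, ‖b n‖ ≤ ‖a n‖)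
    (ha : Summable fun n => a n • e n) : Summable fun n => b n • e n := by
  rw [summable_iff_vanishing_norm] at ha ⊢
  intro ε hε
  obtain ⟨s, hs⟩ := ha ε hε
  exact ⟨s, fun t ht => (he.norm_sum_le t a b fun n _ => h n).trans_lt (hs t ht)⟩

/-- Comparison principle for the norms of convergent expansions. -/
theorem IsUnconditionalBasis.norm_tsum_le [CompleteSpace E] {e : SchauderBasis 𝕜 E}
    (he : IsUnconditionalBasis 1 e) {a b : ℕ → 𝕜} (h : ∀ n, ‖b n‖ ≤ ‖a n‖)
    (ha : Summable fun n => a n • e n) :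
    ‖∑' n, b n • e n‖ ≤ ‖∑' n, a n • e n‖ :=
  le_of_tendsto_of_tendsto' (he.summable_of_le h ha).hasSum.norm ha.hasSum.norm
    fun s => he.norm_sum_le s a b fun n _ => h n

/-- For a `1`-unconditional basis, a series `∑ aₙ eₙ` converges (in the sense of partial sums) if
and only if it is summable over finite sets. -/
theorem IsUnconditionalBasis.summable_iff [CompleteSpace E] {e : SchauderBasis 𝕜 E}
    (he : IsUnconditionalBasis 1 e) (a : ℕ → 𝕜) :
    (Summable fun n => a n • e n) ↔
      ∃ y, Tendsto (fun N => ∑ n ∈ Finset.range N, a n • e n) atTop (𝓝 y) := by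
  refine ⟨fun h => ⟨_, h.hasSum.tendsto_sum_nat⟩, fun ⟨y, hy⟩ => ?_⟩
  rw [summable_iff_vanishing_norm]
  intro ε hε
  obtain ⟨N, hN⟩ := (Metric.cauchySeq_iff'.1 hy.cauchySeq) ε hε
  refine ⟨Finset.range N, fun t ht => ?_⟩
  set M := max N (t.sup id + 1) with hM
  have htM : t ⊆ Finset.Ico N M := by
    intro n hn
    rw [Finset.mem_Ico]
    refine ⟨?_, lt_of_lt_of_le (Nat.lt_succ_of_le (Finset.le_sup (f := id) hn))
      (le_max_right _ _)⟩
    by_contra hlt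
    exact Finset.disjoint_left.1 ht hn (Finset.mem_range.2 (not_le.1 hlt))
  have h1 : ‖∑ n ∈ t, a n • e n‖ ≤ ‖∑ n ∈ Finset.Ico N M, a n • e n‖ := by
    have h2 := he.norm_sum_le (Finset.Ico N M) a (fun n => if n ∈ t then a n else 0)
      (by intro n _; by_cases hn : n ∈ t <;> simp [hn])
    rw [← Finset.sum_subset htM (f := fun n => (if n ∈ t then a n else 0) • e n)
      (by intro n _ hn; simp [hn])] at h2
    rwa [Finset.sum_congr rfl (g := fun n => a n • e n)
      (fun n hn => by simp [hn])] at h2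
  refine h1.trans_lt ?_
  have h3 := hN M (le_max_left _ _)
  rwa [dist_eq_norm, ← Finset.sum_Ico_eq_sub _ (le_max_left _ _)] at h3

end Bases

section DirectSum

variable {𝕜 : Type*} [RCLike 𝕜] {Y : Type*} [NormedAddCommGroup Y] [NormedSpace 𝕜 Y]
  [CompleteSpace Y]

/-- The vector space of all sequences `(xₙ)` in `X` such that `∑ ‖xₙ‖ fₙ` converges in `Y`. -/
def bigSumSubmodule (f : SchauderBasis 𝕜 Y) (hf : IsUnconditionalBasis 1 f)
    (X : Type*) [NormedAddCommGroup X] [NormedSpace 𝕜 X] : Submodule 𝕜 (ℕ → X) where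
  carrier := {x | Summable fun n => ((‖x n‖ : ℝ) : 𝕜) • f n}
  zero_mem' := by simp [summable_zero]
  add_mem' := by
    intro x y hx hy
    refine hf.summable_of_le (a := fun n => ((‖x n‖ : ℝ) : 𝕜) + ((‖y n‖ : ℝ) : 𝕜)) ?_
      (by simpa only [add_smul] using Summable.add hx hy)
    intro n
    rw [← RCLike.ofReal_add, RCLike.norm_ofReal, RCLike.norm_ofReal, abs_of_nonneg (norm_nonneg _),
      abs_of_nonneg (by positivity)]
    exact norm_add_le _ _
  smul_mem' := by
    intro c x hx
    have : (fun n => ((‖(c • x) n‖ : ℝ) : 𝕜) • f n) =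
        fun n => ((‖c‖ : ℝ) : 𝕜) • (((‖x n‖ : ℝ) : 𝕜) • f n) := by
      funext n
      rw [Pi.smul_apply, norm_smul, RCLike.ofReal_mul, mul_smul]
    change Summable _
    rw [this]
    exact Summable.const_smul _ hx

/-- The space `⨁_Y X`, where `f` is a `1`-unconditional basis of `Y`. -/
def BigSum (f : SchauderBasis 𝕜 Y) (hf : IsUnconditionalBasis 1 f)
    (X : Type*) [NormedAddCommGroup X] [NormedSpace 𝕜 X] : Type _ :=
  bigSumSubmodule f hf X

namespace BigSum

variable {f : SchauderBasis 𝕜 Y} {hf : IsUnconditionalBasis 1 f}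
  {X : Type*} [NormedAddCommGroup X] [NormedSpace 𝕜 X]

instance : AddCommGroup (BigSum f hf X) :=
  inferInstanceAs (AddCommGroup (bigSumSubmodule f hf X))

instance : Module 𝕜 (BigSum f hf X) :=
  inferInstanceAs (Module 𝕜 (bigSumSubmodule f hf X))

/-- The norm of `(xₙ)` is the norm in `Y` of `∑ ‖xₙ‖ fₙ`. -/
instance : Norm (BigSum f hf X) := ⟨fun x => ‖∑' n, ((‖x.1 n‖ : ℝ) : 𝕜) • f n‖⟩

theorem normedSpaceCore : NormedSpace.Core 𝕜 (BigSum f hf X) where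
  norm_nonneg x := norm_nonneg (∑' n, ((‖x.1 n‖ : ℝ) : 𝕜) • f n)
  norm_smul c x := by
    change ‖∑' n, ((‖c • x.1 n‖ : ℝ) : 𝕜) • f n‖ = ‖c‖ * ‖∑' n, ((‖x.1 n‖ : ℝ) : 𝕜) • f n‖
    have : (fun n => ((‖c • x.1 n‖ : ℝ) : 𝕜) • f n) =
        fun n => ((‖c‖ : ℝ) : 𝕜) • (((‖x.1 n‖ : ℝ) : 𝕜) • f n) := by
      funext n
      rw [norm_smul, RCLike.ofReal_mul, mul_smul]
    have hx : Summable fun n => ((‖x.1 n‖ : ℝ) : 𝕜) • f n := x.2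
    rw [this, hx.tsum_const_smul, norm_smul, RCLike.norm_ofReal, abs_norm]
  norm_triangle x y := by
    change ‖∑' n, ((‖x.1 n + y.1 n‖ : ℝ) : 𝕜) • f n‖ ≤
      ‖∑' n, ((‖x.1 n‖ : ℝ) : 𝕜) • f n‖ + ‖∑' n, ((‖y.1 n‖ : ℝ) : 𝕜) • f n‖
    have hx : Summable fun n => ((‖x.1 n‖ : ℝ) : 𝕜) • f n := x.2
    have hy : Summable fun n => ((‖y.1 n‖ : ℝ) : 𝕜) • f n := y.2
    have hxy : Summable fun n => (((‖x.1 n‖ : ℝ) : 𝕜) + ((‖y.1 n‖ : ℝ) : 𝕜)) • f n := by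
      simpa only [add_smul] using Summable.add hx hy
    refine (hf.norm_tsum_le (fun n => ?_) hxy).trans ?_
    · rw [← RCLike.ofReal_add, RCLike.norm_ofReal, RCLike.norm_ofReal,
        abs_of_nonneg (norm_nonneg _), abs_of_nonneg (by positivity)]
      exact norm_add_le _ _
    · simp only [add_smul]
      rw [Summable.tsum_add hx hy]
      exact norm_add_le _ _
  norm_eq_zero_iff x := by
    change ‖∑' n, ((‖x.1 n‖ : ℝ) : 𝕜) • f n‖ = 0 ↔ x = 0
    constructor
    · intro h
      have hx : Summable fun n => ((‖x.1 n‖ : ℝ) : 𝕜) • f n := x.2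
      refine Subtype.ext (funext fun m => ?_)
      have h1 := congrArg (f.coord m) (norm_eq_zero.1 h)
      rw [(f.coord m).map_tsum hx, map_zero] at h1
      rw [tsum_eq_single m] at h1
      · have h2 : x.1 m = 0 := by simpa [f.ortho] using h1
        exact h2
      · intro n hn
        simp [f.ortho, hn.symm]
    · rintro rfl
      have : ∀ n, (0 : BigSum f hf X).1 n = 0 := fun n => rfl
      simp [this]

instance : NormedAddCommGroup (BigSum f hf X) := NormedAddCommGroup.ofCore normedSpaceCore

instance : NormedSpace 𝕜 (BigSum f hf X) := NormedSpace.ofCore normedSpaceCore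

theorem norm_def (x : BigSum f hf X) : ‖x‖ = ‖∑' n, ((‖x.1 n‖ : ℝ) : 𝕜) • f n‖ := rfl

end BigSum

end DirectSum

/-- `Z` contains a complemented copy of `E`: some closed subspace of `Z`, which is the range of a
bounded linear projection, is isomorphic to `E`. -/
def ContainsComplementedCopy (𝕜 : Type*) [RCLike 𝕜]
    (Z : Type*) [NormedAddCommGroup Z] [NormedSpace 𝕜 Z]
    (E : Type*) [NormedAddCommGroup E] [NormedSpace 𝕜 E] : Prop :=
  ∃ V : Submodule 𝕜 Z, V.ClosedComplemented ∧ Nonempty (E ≃L[𝕜] V)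

/-- `X` has a `1`-unconditional basis, and for some normalized `1`-unconditional basis of `Y` with
continuous backward shift, `Z` contains a complemented copy of `⨁_Y X`. -/
def ContainsComplementedBigSum (𝕜 : Type*) [RCLike 𝕜]
    (Z : Type*) [NormedAddCommGroup Z] [NormedSpace 𝕜 Z]
    (X : Type*) [NormedAddCommGroup X] [NormedSpace 𝕜 X]
    (Y : Type*) [NormedAddCommGroup Y] [NormedSpace 𝕜 Y] [CompleteSpace Y] : Prop :=
  (∃ e : SchauderBasis 𝕜 X, IsUnconditionalBasis 1 e) ∧
  ∃ (f : SchauderBasis 𝕜 Y) (hf : IsUnconditionalBasis 1 f),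
    IsNormalizedBasis f ∧ HasContinuousBackwardShift f ∧
    ContainsComplementedCopy 𝕜 Z (BigSum f hf X)

end

/-! Split `Z` as the image of `⨁_Y X` under `ι` plus the kernel of `π`. Let `g`, `c` be the
normalized basis of `X` and its coordinates; row `k` of a sequence in `X` consists of the `c k` of
its entries. A single operator `T` is built on `Z`, and row 0 is rescaled by `t > 0`, which amounts
to conjugating `T` by `scaling P t`.

On `⨁_Y X`, `T` is a backward shift with operator weights, whose product up to time `n` is a
`blockOp` with `k = activeRow n` and `a = expansion n`. This block expands by `a`, except along `g
k`, but ties row 0 to row `k`: `c 0 - c k` stays bounded on the output independently of `a`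
(`coord_sub_coord_blockOp`). Thus an orbit is large in row 0 of its entry 0 only if it is about as
large in row `k`. Conversely, a vector whose rows 0 and `k` agree has a preimage of size `O(1/a)`. A
finite vector can therefore be approximated from a tiny vector, the error being a copy of its row 0
placed in a far row `k`.

For large `t` this copy is negligible beside row 0, so every `δ > 0` is reached for suitable `t`
(`isEpsHypercyclicFor`). For small `t` it is too expensive, and each given `ε < 1` eventually fails
(`not_isEpsHypercyclicFor`). Since the admissible `δ` vary continuously with `t`, an infimum over
`t` realizes every threshold (`everyEpsIsThreshold_of_scaling`). The kernel of `π` is covered by an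
operator `N` fed by entry 0 of the sequence. For `c₀` and `ℓᵖ`, splitting indices by `Nat.pair`
gives `E ≅ ⨁_E E`. -/

section Scaling

/-! ### Rescaling along a projection, and the Baire criterion. -/

variable {𝕜 : Type*} [RCLike 𝕜] {Z : Type*} [NormedAddCommGroup Z] [NormedSpace 𝕜 Z]

/-- `T` is `δ`-hypercyclic for the norm `z ↦ ‖S z‖`. -/
def IsEpsHypercyclicFor (S T : Z →L[𝕜] Z) (δ : ℝ) : Prop :=
  ∃ x : Z, ∀ y : Z, y ≠ 0 → ∃ n : ℕ, ‖S ((T ^ n) x - y)‖ ≤ δ * ‖S y‖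

/-- The operator which is multiplication by `t` on the range of the projection `P` and the identity
on its kernel. -/
def scaling (P : Z →L[𝕜] Z) (t : ℝ) : Z →L[𝕜] Z := 1 + ((t - 1 : ℝ) : 𝕜) • P

theorem scaling_apply (P : Z →L[𝕜] Z) (t : ℝ) (z : Z) :
    scaling P t z = z + ((t - 1 : ℝ) : 𝕜) • P z := rfl

theorem scaling_scaling {P : Z →L[𝕜] Z} (hP : ∀ z, P (P z) = P z) (s t : ℝ) (z : Z) :
    scaling P s (scaling P t z) = scaling P (s * t) z := by
  simp only [scaling_apply, map_add, map_smul, hP]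
  push_cast
  module

theorem scaling_one (P : Z →L[𝕜] Z) (z : Z) : scaling P 1 z = z := by
  simp [scaling_apply]

theorem norm_scaling_apply_le (P : Z →L[𝕜] Z) (t : ℝ) (z : Z) :
    ‖scaling P t z‖ ≤ (1 + |t - 1| * ‖P‖) * ‖z‖ := by
  rw [scaling_apply]
  refine (norm_add_le _ _).trans ?_
  rw [norm_smul, RCLike.norm_ofReal, add_mul, one_mul, mul_assoc]
  gcongr
  exact P.le_opNorm z

theorem IsEpsHypercyclicFor.mono {S T : Z →L[𝕜] Z} {δ δ' : ℝ} (h : IsEpsHypercyclicFor S T δ)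
    (hδ : δ ≤ δ') : IsEpsHypercyclicFor S T δ' := by
  obtain ⟨x, hx⟩ := h
  refine ⟨x, fun y hy => ?_⟩
  obtain ⟨n, hn⟩ := hx y hy
  exact ⟨n, hn.trans (by gcongr)⟩

/-- Both norms are compared through `scaling P (s / t)` and its inverse; the loss tends to `1` as `s
/ t` tends to `1`, which gives continuity in the scaling. -/
theorem IsEpsHypercyclicFor.change_scaling {P T : Z →L[𝕜] Z} (hP : ∀ z, P (P z) = P z)
    {s t δ : ℝ} (hs : s ≠ 0) (ht : t ≠ 0) (hδ : 0 ≤ δ)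
    (h : IsEpsHypercyclicFor (scaling P t) T δ) :
    IsEpsHypercyclicFor (scaling P s) T
      ((1 + |s / t - 1| * ‖P‖) * (δ * (1 + |t / s - 1| * ‖P‖))) := by
  obtain ⟨x, hx⟩ := h
  refine ⟨x, fun y hy => ?_⟩
  obtain ⟨n, hn⟩ := hx y hy
  refine ⟨n, ?_⟩
  have h1 : scaling P s ((T ^ n) x - y) = scaling P (s / t) (scaling P t ((T ^ n) x - y)) := by
    rw [scaling_scaling hP, div_mul_cancel₀ _ ht]
  have h2 : scaling P t y = scaling P (t / s) (scaling P s y) := by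
    rw [scaling_scaling hP, div_mul_cancel₀ _ hs]
  rw [h1]
  refine (norm_scaling_apply_le P _ _).trans ?_
  rw [mul_assoc, mul_assoc]
  gcongr
  refine hn.trans ?_
  gcongr
  rw [h2]
  exact norm_scaling_apply_le P _ _

/-- Trades a change of norm for a change of operator, so that one `T` can be studied under all the
norms `‖scaling P t ·‖`. -/
theorem isEpsHypercyclic_conj_iff {P : Z →L[𝕜] Z} (hP : ∀ z, P (P z) = P z) (T : Z →L[𝕜] Z)
    {t : ℝ} (ht : t ≠ 0) (δ : ℝ) :
    IsEpsHypercyclic (scaling P t * T * scaling P t⁻¹) δ ↔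
      IsEpsHypercyclicFor (scaling P t) T δ := by
  have hl : ∀ z, scaling P t⁻¹ (scaling P t z) = z := fun z => by
    rw [scaling_scaling hP, inv_mul_cancel₀ ht, scaling_one]
  have hr : ∀ z, scaling P t (scaling P t⁻¹ z) = z := fun z => by
    rw [scaling_scaling hP, mul_inv_cancel₀ ht, scaling_one]
  have hpow : ∀ (n : ℕ) (z : Z), ((scaling P t * T * scaling P t⁻¹) ^ n) z =
      scaling P t ((T ^ n) (scaling P t⁻¹ z)) := by
    intro n
    induction n with
    | zero => intro z; simp [hr]
    | succ n ih => intro z; rw [pow_succ, pow_succ]; simp [ih, hl]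
  constructor
  · rintro ⟨x, hx⟩
    refine ⟨scaling P t⁻¹ x, fun y hy => ?_⟩
    have hy' : scaling P t y ≠ 0 := fun h => hy (by rw [← hl y, h, map_zero])
    obtain ⟨n, hn⟩ := hx _ hy'
    refine ⟨n, ?_⟩
    rwa [hpow, ← map_sub] at hn
  · rintro ⟨x, hx⟩
    refine ⟨scaling P t x, fun y hy => ?_⟩
    have hy' : scaling P t⁻¹ y ≠ 0 := fun h => hy (by rw [← hr y, h, map_zero])
    obtain ⟨n, hn⟩ := hx _ hy'
    refine ⟨n, ?_⟩
    rw [map_sub, hr] at hn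
    rwa [hpow, hl]

/-- An intermediate value argument: if `T` is `δ`-hypercyclic with arbitrarily small `δ` for large
scalings, and only with `δ` close to `1` for small scalings, then all thresholds are attained. -/
theorem everyEpsIsThreshold_of_scaling {P T : Z →L[𝕜] Z} (hP : ∀ z, P (P z) = P z)
    (hlow : ∀ ε ∈ Set.Ioo (0 : ℝ) 1, ∃ t₀ > 0, ∀ t, 0 < t → t ≤ t₀ →
      ¬ IsEpsHypercyclicFor (scaling P t) T ε)
    (hup : ∀ ε > 0, ∃ t > 0, IsEpsHypercyclicFor (scaling P t) T ε) :
    EveryEpsIsThreshold 𝕜 Z := by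
  intro ε hε
  obtain ⟨t₀, ht₀, hlow⟩ := hlow ε hε
  set A : Set ℝ := {t | 0 < t ∧ IsEpsHypercyclicFor (scaling P t) T ε} with hA
  have hne : A.Nonempty := by
    obtain ⟨t, ht, h⟩ := hup ε hε.1
    exact ⟨t, ht, h⟩
  have hlb : t₀ ∈ lowerBounds A := fun t ht => by
    by_contra hlt
    exact hlow t ht.1 (not_le.1 hlt).le ht.2
  have hbdd : BddBelow A := ⟨t₀, hlb⟩
  set τ := sInf A with hτ
  have hτ0 : 0 < τ := ht₀.trans_le (le_csInf hne hlb)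
  have hlim : ∀ δ : ℝ, Tendsto (fun t : ℝ =>
      (1 + |τ / t - 1| * ‖P‖) * (δ * (1 + |t / τ - 1| * ‖P‖))) (𝓝 τ) (𝓝 δ) := by
    intro δ
    have : ContinuousAt (fun t : ℝ =>
      (1 + |τ / t - 1| * ‖P‖) * (δ * (1 + |t / τ - 1| * ‖P‖))) τ := by
      have := hτ0.ne'
      fun_prop (disch := assumption)
    simpa [ContinuousAt, div_self hτ0.ne'] using this
  have hlim' : ∀ δ : ℝ, Tendsto (fun t : ℝ =>
      (1 + |t / τ - 1| * ‖P‖) * (δ * (1 + |τ / t - 1| * ‖P‖))) (𝓝 τ) (𝓝 δ) := by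
    intro δ
    refine (hlim δ).congr fun t => by ring
  refine ⟨scaling P τ * T * scaling P τ⁻¹, fun δ hδ => ?_, fun δ hδ => ?_⟩
  · rw [isEpsHypercyclic_conj_iff hP T hτ0.ne']
    intro h
    have h1 : ∀ᶠ t in 𝓝[<] τ, IsEpsHypercyclicFor (scaling P t) T ε := by
      filter_upwards [nhdsWithin_le_nhds ((hlim' δ).eventually_lt_const hδ.2),
        nhdsWithin_le_nhds (lt_mem_nhds hτ0)] with t ht htpos
      exact (h.change_scaling hP htpos.ne' hτ0.ne' hδ.1.le).mono ht.le
    obtain ⟨t, ⟨ht, htpos⟩, htlt⟩ := ((h1.and (nhdsWithin_le_nhds (lt_mem_nhds hτ0))).and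
      self_mem_nhdsWithin).exists
    exact absurd (csInf_le hbdd (show t ∈ A from ⟨htpos, ht⟩)) (not_le.2 htlt)
  · rw [isEpsHypercyclic_conj_iff hP T hτ0.ne']
    -- `A` need not be an interval or contain `τ`; points of `A` close to `τ` suffice.
    have h1 : ∃ᶠ t in 𝓝 τ, t ∈ A :=
      mem_closure_iff_frequently.1 (csInf_mem_closure hne hbdd)
    obtain ⟨t, ht, hlt⟩ := (h1.and_eventually ((hlim ε).eventually_lt_const hδ.1)).exists
    exact (ht.2.change_scaling hP hτ0.ne' ht.1.ne' hε.1.le).mono hlt.le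

/-- A Baire category criterion for `δ`-hypercyclicity. -/
theorem isEpsHypercyclicFor_of_dense [CompleteSpace Z] [TopologicalSpace.SeparableSpace Z]
    {S S' T : Z →L[𝕜] Z} (hS : ∀ z, S' (S z) = z) {γ δ : ℝ} (hδ : γ < δ)
    {D : Set Z} (hD : Dense D)
    (hker : ∀ z ∈ D, ∃ L : ℕ, ∀ n ≥ L, (T ^ n) z = 0)
    (happrox : ∀ z ∈ D, ∀ κ > 0, ∀ L : ℕ, ∃ n ≥ L, ∃ u : Z, ‖u‖ < κ ∧
      ‖S ((T ^ n) u - z)‖ ≤ γ * ‖S z‖) :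
    IsEpsHypercyclicFor S T δ := by
  obtain ⟨D', hD', hc, hd⟩ := hD.exists_countable_dense_subset
  obtain ⟨γ', hγ', hδ'⟩ := exists_between hδ
  have hSne : ∀ z, z ≠ 0 → 0 < ‖S z‖ := fun z hz => norm_pos_iff.2 fun h => hz (by
    rw [← hS z, h, map_zero])
  set O : Z → Set Z := fun z => ⋃ n : ℕ, {x | ‖S ((T ^ n) x - z)‖ < γ' * ‖S z‖} with hO
  have hopen : ∀ z ∈ D' \ {0}, IsOpen (O z) := fun z _ => isOpen_iUnion fun n =>
    isOpen_lt (by fun_prop) continuous_const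
  have hdense : ∀ z ∈ D' \ {0}, Dense (O z) := by
    rintro z ⟨hz, hz0⟩
    rw [Metric.dense_iff]
    intro x r hr
    obtain ⟨x', hx', hxD⟩ := Metric.dense_iff.1 hD x (r / 2) (half_pos hr)
    obtain ⟨L, hL⟩ := hker x' hxD
    obtain ⟨n, hn, u, hu, hnu⟩ := happrox z (hD' hz) (r / 2) (half_pos hr) L
    -- `T ^ n` kills `x'`, so `x' + u` is close to `x` while its image is that of `u`.
    refine ⟨x' + u, ?_, Set.mem_iUnion.2 ⟨n, ?_⟩⟩
    · rw [Metric.mem_ball, dist_eq_norm] at hx' ⊢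
      calc ‖x' + u - x‖ = ‖(x' - x) + u‖ := by congr 1; abel
        _ ≤ ‖x' - x‖ + ‖u‖ := norm_add_le _ _
        _ < r := by linarith
    · rw [Set.mem_ofPred_eq, map_add, hL n hn, zero_add]
      exact hnu.trans_lt (mul_lt_mul_of_pos_right hγ' (hSne z hz0))
  have hG : Dense (⋂ z ∈ D' \ {0}, O z) :=
    dense_biInter_of_isOpen hopen (hc.mono Set.sdiff_subset) hdense
  obtain ⟨x, hx⟩ := hG.nonempty
  refine ⟨x, fun y hy => ?_⟩
  -- The gap between `γ'` and `δ` pays for replacing `y` by a nearby nonzero `z` of the countable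
  -- dense set.
  have hcont : Tendsto (fun z => γ' * ‖S z‖ + ‖S (z - y)‖) (𝓝 y) (𝓝 (γ' * ‖S y‖)) := by
    have : Continuous fun z => γ' * ‖S z‖ + ‖S (z - y)‖ := by fun_prop
    simpa using this.tendsto y
  have hev := (hcont.eventually_lt_const (mul_lt_mul_of_pos_right hδ' (hSne y hy))).and
    (eventually_ne_nhds hy)
  obtain ⟨z, hzD, hz, hz0⟩ := (mem_closure_iff_frequently.1 (hd y)).and_eventually hev |>.exists
  obtain ⟨n, hn⟩ := Set.mem_iUnion.1 (Set.mem_iInter₂.1 hx z ⟨hzD, hz0⟩)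
  refine ⟨n, ?_⟩
  rw [Set.mem_ofPred_eq] at hn
  calc ‖S ((T ^ n) x - y)‖ = ‖S ((T ^ n) x - z) + S (z - y)‖ := by rw [← map_add]; congr 2; abel
    _ ≤ ‖S ((T ^ n) x - z)‖ + ‖S (z - y)‖ := norm_add_le _ _
    _ ≤ δ * ‖S y‖ := by linarith

end Scaling

noncomputable section

/-! ### The schedule of active rows and expansion factors. -/

section Schedule

/-- The row which is not expanded at time `n`. -/
def activeRow (n : ℕ) : ℕ := n.sqrt + 1

/-- The exponent of the expansion at time `n`: it goes up and down between consecutive squares. -/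
def level (n : ℕ) : ℕ := min (n - n.sqrt * n.sqrt) (n.sqrt * n.sqrt + 2 * n.sqrt - n)

/-- The expansion factor at time `n`. -/
def expansion (n : ℕ) : ℝ := 2 ^ level n

theorem expansion_pos (n : ℕ) : 0 < expansion n := by unfold expansion; positivity

/-- The active row changes only just before a perfect square, where both factors equal `1`;
elsewhere the exponent moves by at most one. These two cases are what bounds the weights. -/
theorem expansion_succ (n : ℕ) :
    (activeRow (n + 1) = activeRow n ∧
      expansion (n + 1) / expansion n ∈ Set.Icc (1 / 2 : ℝ) 2) ∨
    (expansion n = 1 ∧ expansion (n + 1) = 1) := by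
  have h1 := Nat.sqrt_le n
  have h2 := Nat.sqrt_le_add n
  have hpos := expansion_pos n
  rcases Nat.sqrt_succ_le_succ_sqrt n |>.eq_or_lt with h | h
  · right
    have h3 := Nat.sqrt_le (n + 1)
    simp only [Nat.succ_eq_add_one] at h
    rw [h] at h3
    have h4 : n + 1 = (n.sqrt + 1) * (n.sqrt + 1) := by nlinarith
    have e1 : level n = 0 := by
      unfold level
      have : n.sqrt * n.sqrt + 2 * n.sqrt - n = 0 := by
        have : (n.sqrt + 1) * (n.sqrt + 1) = n.sqrt * n.sqrt + 2 * n.sqrt + 1 := by ring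
        omega
      simp [this]
    have e2 : level (n + 1) = 0 := by
      unfold level
      rw [h]
      simp [h4]
    simp [expansion, e1, e2]
  · left
    have h3 : (n + 1).sqrt = n.sqrt :=
      le_antisymm (Nat.lt_succ_iff.1 h) (Nat.sqrt_le_sqrt (Nat.le_succ n))
    refine ⟨by simp [activeRow, h3], ?_⟩
    have h4 : level (n + 1) ≤ level n + 1 ∧ level n ≤ level (n + 1) + 1 := by
      unfold level
      rw [h3]
      omega
    rw [Set.mem_Icc, le_div_iff₀ hpos, div_le_iff₀ hpos]
    unfold expansion
    constructor
    · have := pow_le_pow_right₀ (one_le_two (α := ℝ)) h4.2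
      rw [pow_succ] at this
      linarith
    · have := pow_le_pow_right₀ (one_le_two (α := ℝ)) h4.1
      rw [pow_succ] at this
      linarith

theorem activeRow_window {q i : ℕ} (hi : i ≤ q) : activeRow (q * q + q + i) = q + 1 := by
  have : (q * q + q + i).sqrt = q := by
    refine le_antisymm (Nat.lt_succ_iff.1 (Nat.sqrt_lt.2 ?_)) (Nat.le_sqrt.2 ?_)
    · simp only [Nat.succ_eq_add_one]
      nlinarith
    · omega
  rw [activeRow, this]

/-- The descending half of the block of times starting at `q * q`. It provides `q + 1` consecutive
times with the same active row, so finitely many entries can be lifted together. -/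
theorem expansion_window {q i : ℕ} (hi : i ≤ q) : (2 : ℝ) ^ (q - i) ≤ expansion (q * q + q + i) := by
  have h := activeRow_window hi
  have h' : (q * q + q + i).sqrt = q := by simpa [activeRow] using h
  unfold expansion level
  rw [h']
  gcongr
  · norm_num
  · omega

end Schedule

/-! ### Block operators on `X` and the weights. -/

section BlockOperators

variable {𝕜 : Type*} [RCLike 𝕜] {X : Type*} [NormedAddCommGroup X] [NormedSpace 𝕜 X]

/-- A biorthogonal system of vectors of norm one and functionals of norm at most one, whose vectors
have a dense span. -/
structure IsBoundedBiorthogonal (g : ℕ → X) (c : ℕ → X →L[𝕜] 𝕜) : Prop where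
  coord_self : ∀ i, c i (g i) = 1
  coord_ne : ∀ i j, i ≠ j → c i (g j) = 0
  norm_vec : ∀ i, ‖g i‖ = 1
  norm_coord_le : ∀ i x, ‖c i x‖ ≤ ‖x‖
  dense_span : Dense (Submodule.span 𝕜 (Set.range g) : Set X)

/-- The operator mapping `g 0` to `a (g 0 + g k)` and `g k` to `g k`, and which is multiplication
by `a` on the other vectors of the system. -/
def blockOp (g : ℕ → X) (c : ℕ → X →L[𝕜] 𝕜) (k : ℕ) (a : ℝ) : X →L[𝕜] X :=
  (a : 𝕜) • ContinuousLinearMap.id 𝕜 X +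
    ((1 - (a : 𝕜)) • c k + (a : 𝕜) • c 0).smulRight (g k)

/-- The inverse of `blockOp g c k a`. -/
def blockInv (g : ℕ → X) (c : ℕ → X →L[𝕜] 𝕜) (k : ℕ) (a : ℝ) : X →L[𝕜] X :=
  (a : 𝕜)⁻¹ • ContinuousLinearMap.id 𝕜 X +
    ((1 - (a : 𝕜)⁻¹) • c k - c 0).smulRight (g k)

variable {g : ℕ → X} {c : ℕ → X →L[𝕜] 𝕜}

theorem blockOp_apply (k : ℕ) (a : ℝ) (x : X) :
    blockOp g c k a x = (a : 𝕜) • x + ((1 - (a : 𝕜)) * c k x + a * c 0 x) • g k := by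
  simp [blockOp]

theorem blockInv_apply (k : ℕ) (a : ℝ) (x : X) :
    blockInv g c k a x = (a : 𝕜)⁻¹ • x + ((1 - (a : 𝕜)⁻¹) * c k x - c 0 x) • g k := by
  simp [blockInv]

namespace IsBoundedBiorthogonal

variable (hg : IsBoundedBiorthogonal g c)

include hg

theorem blockInv_blockOp {k : ℕ} (hk : k ≠ 0) {a : ℝ} (ha : a ≠ 0) (x : X) :
    blockInv g c k a (blockOp g c k a x) = x := by
  have ha' : (a : 𝕜) ≠ 0 := by exact_mod_cast ha
  simp only [blockInv_apply, blockOp_apply, map_add, map_smul, hg.coord_self,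
    hg.coord_ne 0 k hk.symm]
  match_scalars
  · field_simp
  · field_simp
    ring

theorem blockOp_blockInv {k : ℕ} (hk : k ≠ 0) {a : ℝ} (ha : a ≠ 0) (x : X) :
    blockOp g c k a (blockInv g c k a x) = x := by
  have ha' : (a : 𝕜) ≠ 0 := by exact_mod_cast ha
  simp only [blockInv_apply, blockOp_apply, map_add, map_smul, hg.coord_self,
    hg.coord_ne 0 k hk.symm]
  match_scalars
  · field_simp
  · field_simp
    ring

/-- The functional `c 0 - c k` is bounded on the range of `blockOp g c k a`, uniformly in `a`. -/
theorem coord_sub_coord_blockOp {k : ℕ} (hk : k ≠ 0) (a : ℝ) (x : X) :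
    c 0 (blockOp g c k a x) - c k (blockOp g c k a x) = -c k x := by
  simp only [blockOp_apply, map_add, map_smul, hg.coord_self, hg.coord_ne 0 k hk.symm, smul_eq_mul]
  ring

theorem norm_smul_vec (k : ℕ) (b : 𝕜) : ‖b • g k‖ = ‖b‖ := by
  rw [norm_smul, hg.norm_vec, mul_one]

/-- On the hyperplane `c 0 = c k` the terms of `blockInv` not damped by `a⁻¹` cancel. -/
theorem norm_blockInv_le_of_eq {k : ℕ} {a : ℝ} (ha : 0 < a) {x : X} (hx : c 0 x = c k x) :
    ‖blockInv g c k a x‖ ≤ 2 * a⁻¹ * ‖x‖ := by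
  have h : blockInv g c k a x = (a : 𝕜)⁻¹ • (x - c k x • g k) := by
    rw [blockInv_apply, hx]
    module
  rw [h, norm_smul, norm_inv, RCLike.norm_ofReal, abs_of_pos ha]
  have h2 : ‖x - c k x • g k‖ ≤ 2 * ‖x‖ := by
    refine (norm_sub_le _ _).trans ?_
    rw [hg.norm_smul_vec]
    linarith [hg.norm_coord_le k x]
  have := mul_le_mul_of_nonneg_left h2 (inv_pos.2 ha).le
  linarith

/-- For a common row `k` the `c 0` terms cancel: the product multiplies by `b / a` and fixes `g k`,
so only the ratio matters. -/
theorem norm_blockInv_blockOp_le {k : ℕ} (hk : k ≠ 0) {a b : ℝ} (ha : 0 < a)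
    (hab : b / a ∈ Set.Icc (1 / 2 : ℝ) 2) (x : X) :
    ‖blockInv g c k a (blockOp g c k b x)‖ ≤ 5 * ‖x‖ := by
  have ha' : (a : 𝕜) ≠ 0 := by exact_mod_cast ha.ne'
  have h : blockInv g c k a (blockOp g c k b x) =
      ((b / a : ℝ) : 𝕜) • x + (((1 - b / a : ℝ) : 𝕜) * c k x) • g k := by
    simp only [blockInv_apply, blockOp_apply, map_add, map_smul, hg.coord_self,
      hg.coord_ne 0 k hk.symm]
    push_cast
    match_scalars <;> field_simp
    ring
  rw [h]
  refine (norm_add_le _ _).trans ?_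
  rw [hg.norm_smul_vec, norm_smul, norm_mul, RCLike.norm_ofReal, RCLike.norm_ofReal]
  have h1 : |b / a| ≤ 2 := abs_le.2 ⟨by linarith [hab.1], hab.2⟩
  have h2 : |1 - b / a| ≤ 2 := abs_le.2 ⟨by linarith [hab.2], by linarith [hab.1]⟩
  have h3 := hg.norm_coord_le k x
  have h4 : |b / a| * ‖x‖ ≤ 2 * ‖x‖ := by gcongr
  have h5 : |1 - b / a| * ‖c k x‖ ≤ 2 * ‖x‖ := by gcongr
  linarith [norm_nonneg x]

/-- With both factors equal to `1`, changing the row costs only the perturbation `c 0 x • (g l - g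
k)`. -/
theorem norm_blockInv_blockOp_one_le {k l : ℕ} (hl : l ≠ 0) (x : X) :
    ‖blockInv g c k 1 (blockOp g c l 1 x)‖ ≤ 5 * ‖x‖ := by
  have h : blockInv g c k 1 (blockOp g c l 1 x) = x + c 0 x • g l - c 0 x • g k := by
    simp only [blockInv_apply, blockOp_apply, map_add, map_smul, hg.coord_ne 0 l hl.symm]
    simp [sub_eq_add_neg]
    abel
  rw [h]
  have h1 := norm_sub_le (x + c 0 x • g l) (c 0 x • g k)
  have h2 := norm_add_le x (c 0 x • g l)
  rw [hg.norm_smul_vec] at h1 h2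
  linarith [hg.norm_coord_le 0 x, norm_nonneg x]

end IsBoundedBiorthogonal

/-- The product of the first `n` weights. -/
def weightProd (g : ℕ → X) (c : ℕ → X →L[𝕜] 𝕜) (n : ℕ) : X →L[𝕜] X :=
  blockOp g c (activeRow n) (expansion n)

/-- The inverse of the product of the first `n` weights. -/
def weightProdInv (g : ℕ → X) (c : ℕ → X →L[𝕜] 𝕜) (n : ℕ) : X →L[𝕜] X :=
  blockInv g c (activeRow n) (expansion n)

/-- The operator weights of the shift. -/
def weight (g : ℕ → X) (c : ℕ → X →L[𝕜] 𝕜) (n : ℕ) : X →L[𝕜] X :=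
  weightProdInv g c n ∘L weightProd g c (n + 1)

namespace IsBoundedBiorthogonal

variable (hg : IsBoundedBiorthogonal g c)

include hg

theorem weightProd_weightProdInv (n : ℕ) (x : X) :
    weightProd g c n (weightProdInv g c n x) = x :=
  hg.blockOp_blockInv (Nat.succ_ne_zero _) (expansion_pos n).ne' x

theorem weightProdInv_weightProd (n : ℕ) (x : X) :
    weightProdInv g c n (weightProd g c n x) = x :=
  hg.blockInv_blockOp (Nat.succ_ne_zero _) (expansion_pos n).ne' x

theorem weightProd_weight (n : ℕ) (x : X) :
    weightProd g c n (weight g c n x) = weightProd g c (n + 1) x :=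
  hg.weightProd_weightProdInv n _

theorem norm_weight_le (n : ℕ) (x : X) : ‖weight g c n x‖ ≤ 5 * ‖x‖ := by
  have hk : ∀ m, activeRow m ≠ 0 := fun m => Nat.succ_ne_zero _
  change ‖blockInv g c _ _ (blockOp g c _ _ x)‖ ≤ _
  rcases expansion_succ n with ⟨h, h'⟩ | ⟨h, h'⟩
  · rw [h]
    exact hg.norm_blockInv_blockOp_le (hk n) (expansion_pos n) h' x
  · rw [h, h']
    exact hg.norm_blockInv_blockOp_one_le (hk _) x

end IsBoundedBiorthogonal

theorem weightProd_zero (x : X) : weightProd g c 0 x = x + c 0 x • g 1 := by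
  simp [weightProd, activeRow, expansion, level, blockOp_apply]

end BlockOperators

end

/-! ### Operators on the sum space. -/

noncomputable section

theorem hasSum_norm_pi_single {𝕜 : Type*} [RCLike 𝕜] {Y : Type*} [NormedAddCommGroup Y]
    [NormedSpace 𝕜 Y] {X : Type*} [NormedAddCommGroup X]
    [NormedSpace 𝕜 X] (f : ℕ → Y) (n : ℕ) (x : X) :
    HasSum (fun m => ((‖LinearMap.single 𝕜 (fun _ : ℕ => X) n x m‖ : ℝ) : 𝕜) • f m)
      (((‖x‖ : ℝ) : 𝕜) • f n) := by
  convert hasSum_single n _ using 1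
  · simp
  · intro m hm
    simp [hm]

namespace BigSum

variable {𝕜 : Type*} [RCLike 𝕜] {Y : Type*} [NormedAddCommGroup Y] [NormedSpace 𝕜 Y]
  [CompleteSpace Y] {f : SchauderBasis 𝕜 Y} {hf : IsUnconditionalBasis 1 f}
  {X : Type*} [NormedAddCommGroup X] [NormedSpace 𝕜 X]

@[simp] theorem add_val (x y : BigSum f hf X) (n : ℕ) : (x + y).1 n = x.1 n + y.1 n := rfl

@[simp] theorem sub_val (x y : BigSum f hf X) (n : ℕ) : (x - y).1 n = x.1 n - y.1 n := rfl

@[simp] theorem zero_val (n : ℕ) : (0 : BigSum f hf X).1 n = 0 := rfl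

theorem summable_norm (x : BigSum f hf X) : Summable fun n => ((‖x.1 n‖ : ℝ) : 𝕜) • f n := x.2

theorem norm_le_of_forall_le {x y : BigSum f hf X} (h : ∀ n, ‖x.1 n‖ ≤ ‖y.1 n‖) : ‖x‖ ≤ ‖y‖ := by
  rw [norm_def, norm_def]
  refine hf.norm_tsum_le (fun n => ?_) y.summable_norm
  simpa [RCLike.norm_ofReal] using h n

theorem norm_val_le (hn : IsNormalizedBasis f) (x : BigSum f hf X) (n : ℕ) : ‖x.1 n‖ ≤ ‖x‖ := by
  have h := hf.norm_tsum_le (a := fun m => ((‖x.1 m‖ : ℝ) : 𝕜))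
    (b := fun m => if m = n then ((‖x.1 m‖ : ℝ) : 𝕜) else 0)
    (fun m => by by_cases hm : m = n <;> simp [hm]) x.summable_norm
  rw [tsum_eq_single n (by intro m hm; simp [hm])] at h
  rw [norm_def]
  simpa [norm_smul, hn n] using h

/-- The evaluation at the `n`-th coordinate, as a linear map. -/
def valₗ (n : ℕ) : BigSum f hf X →ₗ[𝕜] X where
  toFun x := x.1 n
  map_add' _ _ := rfl
  map_smul' _ _ := rfl

/-- The evaluation at the `n`-th coordinate. -/
def evalCLM (hn : IsNormalizedBasis f) (n : ℕ) : BigSum f hf X →L[𝕜] X :=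
  (valₗ n).mkContinuous 1 fun x => by
    rw [one_mul]
    exact norm_val_le hn x n

theorem evalCLM_apply (hn : IsNormalizedBasis f) (n : ℕ) (x : BigSum f hf X) :
    evalCLM hn n x = x.1 n := rfl

/-- The continuous linear map into `BigSum f hf X` with given coordinates. -/
def liftCLM {E : Type*} [NormedAddCommGroup E] [NormedSpace 𝕜 E] (F : ℕ → E →ₗ[𝕜] X) (C : ℝ)
    (hsum : ∀ x, Summable fun n => ((‖F n x‖ : ℝ) : 𝕜) • f n)
    (hC : ∀ x, ‖∑' n, ((‖F n x‖ : ℝ) : 𝕜) • f n‖ ≤ C * ‖x‖) : E →L[𝕜] BigSum f hf X :=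
  LinearMap.mkContinuous
    ({ toFun := fun x => (⟨fun n => F n x, hsum x⟩ : bigSumSubmodule f hf X)
       map_add' := fun x y => Subtype.ext (funext fun n => (F n).map_add x y)
       map_smul' := fun a x => Subtype.ext (funext fun n => (F n).map_smul a x) } :
      E →ₗ[𝕜] bigSumSubmodule f hf X) C hC

/-- The sequence whose only non-zero coordinate is the `n`-th one. -/
def single (n : ℕ) : X →L[𝕜] BigSum f hf X :=
  liftCLM (fun m => LinearMap.proj m ∘ₗ LinearMap.single 𝕜 (fun _ : ℕ => X) n) ‖f n‖
    (fun x => (hasSum_norm_pi_single f n x).summable) fun x => by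
      refine (congrArg norm (hasSum_norm_pi_single f n x).tsum_eq).trans_le ?_
      simp [norm_smul, mul_comm]

theorem single_val (n : ℕ) (x : X) (m : ℕ) :
    (single n x : BigSum f hf X).1 m = (Pi.single n x : ℕ → X) m := rfl

theorem norm_single_le (hn : IsNormalizedBasis f) (n : ℕ) (x : X) :
    ‖(single n x : BigSum f hf X)‖ ≤ ‖x‖ := by
  refine (congrArg norm (hasSum_norm_pi_single f n x).tsum_eq).trans_le ?_
  simp [norm_smul, hn n]

theorem summable_and_norm_tsum_le {a : ℕ → 𝕜} (x : BigSum f hf X) (C : ℝ)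
    (h : ∀ n, ‖a n‖ ≤ C * ‖x.1 n‖) :
    (Summable fun n => a n • f n) ∧ ‖∑' n, a n • f n‖ ≤ |C| * ‖x‖ := by
  have h1 : Summable fun n => ((C : 𝕜) * ((‖x.1 n‖ : ℝ) : 𝕜)) • f n := by
    simpa only [mul_smul] using x.summable_norm.const_smul (C : 𝕜)
  have h2 : ∀ n, ‖a n‖ ≤ ‖(C : 𝕜) * ((‖x.1 n‖ : ℝ) : 𝕜)‖ := fun n => by
    rw [norm_mul, RCLike.norm_ofReal, RCLike.norm_ofReal, abs_norm]
    exact (h n).trans (by gcongr; exact le_abs_self C)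
  refine ⟨hf.summable_of_le h2 h1, (hf.norm_tsum_le h2 h1).trans_eq ?_⟩
  simp only [mul_smul]
  rw [x.summable_norm.tsum_const_smul, norm_smul, RCLike.norm_ofReal, norm_def]

/-- The operator acting on the coordinates by a uniformly bounded sequence of operators. -/
def diagCLM (A : ℕ → X →L[𝕜] X) (C : ℝ) (hA : ∀ n x, ‖A n x‖ ≤ C * ‖x‖) :
    BigSum f hf X →L[𝕜] BigSum f hf X :=
  have h (x : BigSum f hf X) := summable_and_norm_tsum_le (a := fun n => ((‖A n (x.1 n)‖ : ℝ) : 𝕜))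
    x C fun n => by simpa [RCLike.norm_ofReal] using hA n (x.1 n)
  liftCLM (fun n => (A n).toLinearMap ∘ₗ valₗ n) |C| (fun x => (h x).1) fun x => (h x).2

theorem hasSum_shift {B : Y →L[𝕜] Y} (hB0 : B (f 0) = 0) (hB : ∀ n, B (f (n + 1)) = f n)
    (x : BigSum f hf X) :
    HasSum (fun n => ((‖x.1 (n + 1)‖ : ℝ) : 𝕜) • f n) (B (∑' n, ((‖x.1 n‖ : ℝ) : 𝕜) • f n)) := by
  have h1 := x.summable_norm.hasSum.mapL B
  rw [← hasSum_nat_add_iff' 1] at h1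
  simpa [hB0, hB] using h1

/-- The backward shift. -/
def shiftCLM (B : Y →L[𝕜] Y) (hB0 : B (f 0) = 0) (hB : ∀ n, B (f (n + 1)) = f n) :
    BigSum f hf X →L[𝕜] BigSum f hf X :=
  liftCLM (fun n => valₗ (n + 1)) ‖B‖ (fun x => (hasSum_shift hB0 hB x).summable) fun x =>
    (congrArg norm (hasSum_shift hB0 hB x).tsum_eq).trans_le (B.le_opNorm _)

theorem sum_single_val (s : Finset ℕ) (y : ℕ → X) (n : ℕ) :
    (∑ j ∈ s, single j (y j) : BigSum f hf X).1 n = if n ∈ s then y n else 0 := by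
  classical
  induction s using Finset.induction_on with
  | empty => simp
  | insert a s ha ih =>
    rw [Finset.sum_insert ha, add_val, ih, single_val]
    by_cases h : n = a
    · subst h; simp [ha]
    · simp [h]

/-- The norm of a remainder of `x` is exactly the norm in `Y` of the same remainder of `∑ ‖xₙ‖ fₙ`.
-/
theorem hasSum_single_val (x : BigSum f hf X) : HasSum (fun n => single n (x.1 n)) x := by
  rw [HasSum, SummationFilter.unconditional_filter, tendsto_iff_norm_sub_tendsto_zero]
  have h : Tendsto (fun s : Finset ℕ => ‖∑' n, ((‖x.1 n‖ : ℝ) : 𝕜) • f n -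
      ∑ n ∈ s, ((‖x.1 n‖ : ℝ) : 𝕜) • f n‖) atTop (𝓝 0) := by
    have h0 := x.summable_norm.hasSum
    rw [HasSum, SummationFilter.unconditional_filter] at h0
    simpa using (h0.const_sub (∑' n, ((‖x.1 n‖ : ℝ) : 𝕜) • f n)).norm
  refine h.congr fun s => ?_
  rw [norm_sub_rev _ x]
  have h1 : HasSum (fun n => if n ∈ s then ((‖x.1 n‖ : ℝ) : 𝕜) • f n else 0)
      (∑ n ∈ s, ((‖x.1 n‖ : ℝ) : 𝕜) • f n) := by
    convert hasSum_sum_of_ne_finset_zero (s := s) (L := .unconditional ℕ) _ using 1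
    · exact Finset.sum_congr rfl fun n hn => by simp [hn]
    · intro n hn
      simp [hn]
  have h2 := (x.summable_norm.hasSum.sub h1).tsum_eq
  refine congrArg norm (h2.symm.trans (tsum_congr fun n => ?_))
  have : (x - ∑ b ∈ s, single b (x.1 b)).1 n = if n ∈ s then 0 else x.1 n := by
    rw [sub_val, sum_single_val]
    split_ifs <;> simp
  rw [this]
  by_cases h : n ∈ s <;> simp [h]

end BigSum
end

noncomputable section

/-! ### The weighted shift, its extension to `Z`, and the obstruction for small scalings. -/

section WeightedShift

variable {𝕜 : Type*} [RCLike 𝕜] {Y : Type*} [NormedAddCommGroup Y] [NormedSpace 𝕜 Y]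
  [CompleteSpace Y] {f : SchauderBasis 𝕜 Y} {hf : IsUnconditionalBasis 1 f}
  {X : Type*} [NormedAddCommGroup X] [NormedSpace 𝕜 X] {g : ℕ → X} {c : ℕ → X →L[𝕜] 𝕜}

namespace IsBoundedBiorthogonal

/-- The operator weighted backward shift. -/
def weightedShift (hg : IsBoundedBiorthogonal g c) (B : Y →L[𝕜] Y) (hB0 : B (f 0) = 0)
    (hB : ∀ n, B (f (n + 1)) = f n) : BigSum f hf X →L[𝕜] BigSum f hf X :=
  BigSum.diagCLM (weight g c) 5 hg.norm_weight_le ∘L BigSum.shiftCLM B hB0 hB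

/-- The weights telescope. Since the products are invertible, this determines every entry of every
iterate. -/
theorem weightProd_weightedShift_pow (hg : IsBoundedBiorthogonal g c) (B : Y →L[𝕜] Y)
    (hB0 : B (f 0) = 0) (hB : ∀ n, B (f (n + 1)) = f n) (n : ℕ) (x : BigSum f hf X) (j : ℕ) :
    weightProd g c j (((hg.weightedShift B hB0 hB ^ n) x).1 j) =
      weightProd g c (j + n) (x.1 (j + n)) := by
  induction n generalizing j with
  | zero => simp
  | succ n ih =>
    rw [pow_succ']
    change weightProd g c j (weight g c j (((hg.weightedShift B hB0 hB ^ n) x).1 (j + 1))) = _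
    rw [hg.weightProd_weight, ih, add_right_comm, add_assoc]

theorem weightProd_injective (hg : IsBoundedBiorthogonal g c) (n : ℕ) :
    Function.Injective (weightProd g c n) :=
  Function.LeftInverse.injective (hg.weightProdInv_weightProd n)

theorem norm_rankOne_le (hg : IsBoundedBiorthogonal g c) (x : X) :
    ‖(c 0).smulRight (g 0) x‖ ≤ 1 * ‖x‖ := by
  rw [ContinuousLinearMap.smulRight_apply, hg.norm_smul_vec, one_mul]
  exact hg.norm_coord_le 0 x

/-- The projection onto the first row. -/
def rowProj (hg : IsBoundedBiorthogonal g c) : BigSum f hf X →L[𝕜] BigSum f hf X :=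
  BigSum.diagCLM (fun _ => (c 0).smulRight (g 0)) 1 fun _ => hg.norm_rankOne_le

theorem rowProj_val (hg : IsBoundedBiorthogonal g c) (x : BigSum f hf X) (n : ℕ) :
    (hg.rowProj x).1 n = c 0 (x.1 n) • g 0 := rfl

theorem rowProj_rowProj (hg : IsBoundedBiorthogonal g c) (x : BigSum f hf X) :
    hg.rowProj (hg.rowProj x) = hg.rowProj x :=
  Subtype.ext (funext fun n => by simp [rowProj_val, hg.coord_self])

variable {Z : Type*} [NormedAddCommGroup Z] [NormedSpace 𝕜 Z]

/-- An operator sending the vectors `g (n + 1)` to small multiples of a dense sequence of the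
kernel of `π`. -/
theorem exists_operator_dense_ker [CompleteSpace Z] [TopologicalSpace.SeparableSpace Z]
    (hg : IsBoundedBiorthogonal g c) (ι : BigSum f hf X →L[𝕜] Z) (π : Z →L[𝕜] BigSum f hf X)
    (hπ : ∀ x, π (ι x) = x) :
    ∃ N : X →L[𝕜] Z, (∀ x, π (N x) = 0) ∧
      ∀ V : Submodule 𝕜 Z, (∀ r, N (g (r + 1)) ∈ V) → ∀ z, z - ι (π z) ∈ V.topologicalClosure := by
  set R : Z →L[𝕜] Z := 1 - ι ∘L π with hR
  have hπR : ∀ z, π (R z) = 0 := fun z => by simp [hR, hπ]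
  set d := TopologicalSpace.denseSeq Z with hd
  -- Damping that makes `∑ F r` converge in operator norm.
  set a : ℕ → ℝ := fun r => (1 / 2) ^ r / (1 + ‖R (d r)‖) with ha
  have hapos : ∀ r, 0 < a r := fun r => by positivity
  -- The index `r + 1` leaves row 0 unused: the kernel component can then be produced from vectors
  -- `p` with `c 0 p = 0`, which need no correction.
  set F : ℕ → X →L[𝕜] Z := fun r => (c (r + 1)).smulRight ((a r : 𝕜) • R (d r)) with hF
  have hFn : ∀ r, ‖F r‖ ≤ (1 / 2) ^ r := fun r => by
    refine ContinuousLinearMap.opNorm_le_bound _ (by positivity) fun x => ?_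
    rw [hF, ContinuousLinearMap.smulRight_apply, norm_smul, norm_smul, RCLike.norm_ofReal,
      abs_of_pos (hapos r), mul_comm]
    have : a r * ‖R (d r)‖ ≤ (1 / 2) ^ r := by
      rw [ha, div_mul_eq_mul_div, div_le_iff₀ (by positivity)]
      gcongr
      linarith
    gcongr
    exact hg.norm_coord_le _ _
  have hFs : Summable F := Summable.of_norm_bounded summable_geometric_two hFn
  have hN : ∀ x, HasSum (fun r => F r x) ((∑' r, F r) x) := fun x =>
    hFs.hasSum.mapL (ContinuousLinearMap.apply 𝕜 Z x)
  refine ⟨∑' r, F r, fun x => ?_, fun V hV z => ?_⟩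
  · have h := (hN x).mapL π
    refine h.unique ?_
    convert hasSum_zero with r
    simp [hF, hπR]
  · have hRd : ∀ r, R (d r) ∈ V := fun r => by
      have h1 : (∑' r, F r) (g (r + 1)) = (a r : 𝕜) • R (d r) := by
        refine (hN _).unique ?_
        convert hasSum_single r _ using 1
        · simp [hF, hg.coord_self]
        · intro s hs
          simp [hF, hg.coord_ne (s + 1) (r + 1) (by omega)]
      have h2 := hV r
      rw [h1] at h2
      exact (V.smul_mem_iff (by exact_mod_cast (hapos r).ne')).1 h2
    change R z ∈ closure (V : Set Z)
    have h3 : z ∈ closure (Set.range d) := TopologicalSpace.denseRange_denseSeq Z z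
    exact map_mem_closure R.continuous h3 (by rintro _ ⟨r, rfl⟩; exact hRd r)

/-- The operator on `Z` built from the weighted shift and an operator `N` with values in the kernel
of `π`. -/
def extendedShift (hg : IsBoundedBiorthogonal g c) (hn : IsNormalizedBasis f) (B : Y →L[𝕜] Y)
    (hB0 : B (f 0) = 0) (hB : ∀ n, B (f (n + 1)) = f n)
    (ι : BigSum f hf X →L[𝕜] Z) (π : Z →L[𝕜] BigSum f hf X) (N : X →L[𝕜] Z) : Z →L[𝕜] Z :=
  ι ∘L hg.weightedShift B hB0 hB ∘L π + N ∘L BigSum.evalCLM hn 0 ∘L π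

section

variable (hg : IsBoundedBiorthogonal g c) (hn : IsNormalizedBasis f) {B : Y →L[𝕜] Y}
  (hB0 : B (f 0) = 0) (hB : ∀ n, B (f (n + 1)) = f n)
  {ι : BigSum f hf X →L[𝕜] Z} {π : Z →L[𝕜] BigSum f hf X} {N : X →L[𝕜] Z}
  (hπ : ∀ x, π (ι x) = x) (hN : ∀ x, π (N x) = 0)

include hπ hN

theorem proj_extendedShift_pow (n : ℕ) (z : Z) :
    π ((hg.extendedShift hn B hB0 hB ι π N ^ n) z) = (hg.weightedShift B hB0 hB ^ n) (π z) := by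
  induction n with
  | zero => rfl
  | succ n ih =>
    rw [pow_succ', pow_succ', mul_apply_eq_comp, mul_apply_eq_comp, ← ih]
    simp [extendedShift, hπ, hN]

/-- Since `π ∘ N = 0`, the kernel component at time `n + 1` is not accumulated: it only sees entry 0
at time `n`. -/
theorem extendedShift_pow_succ (n : ℕ) (z : Z) :
    (hg.extendedShift hn B hB0 hB ι π N ^ (n + 1)) z =
      ι ((hg.weightedShift B hB0 hB ^ (n + 1)) (π z)) +
        N (((hg.weightedShift B hB0 hB ^ n) (π z)).1 0) := by
  rw [pow_succ', pow_succ', mul_apply_eq_comp, mul_apply_eq_comp,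
    ← hg.proj_extendedShift_pow hn hB0 hB hπ hN]
  rfl

omit hN in
theorem coord_zero_scaling (t : ℝ) (z : Z) (n : ℕ) :
    c 0 ((π (scaling (ι ∘L hg.rowProj ∘L π) t z)).1 n) = t * c 0 ((π z).1 n) := by
  have : π (scaling (ι ∘L hg.rowProj ∘L π) t z) =
      π z + ((t - 1 : ℝ) : 𝕜) • hg.rowProj (π z) := by
    simp [scaling_apply, hπ]
  rw [this]
  change c 0 ((π z).1 n + ((t - 1 : ℝ) : 𝕜) • (hg.rowProj (π z)).1 n) = _
  rw [rowProj_val, map_add, map_smul, map_smul, hg.coord_self]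
  simp only [smul_eq_mul]
  push_cast
  ring

omit hN in
theorem coord_scaling {k : ℕ} (hk : k ≠ 0) (t : ℝ) (z : Z) (n : ℕ) :
    c k ((π (scaling (ι ∘L hg.rowProj ∘L π) t z)).1 n) = c k ((π z).1 n) := by
  have : π (scaling (ι ∘L hg.rowProj ∘L π) t z) =
      π z + ((t - 1 : ℝ) : 𝕜) • hg.rowProj (π z) := by
    simp [scaling_apply, hπ]
  rw [this]
  change c k ((π z).1 n + ((t - 1 : ℝ) : 𝕜) • (hg.rowProj (π z)).1 n) = _
  rw [rowProj_val, map_add, map_smul, map_smul, hg.coord_ne k 0 hk]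
  simp

/-- Telescoping identifies entry 0 of the orbit with an output of `blockOp`, on which `c 0 - c k`
does not feel the expansion. -/
theorem norm_coord_sub_coord_le (n : ℕ) (z : Z) :
    ‖c 0 ((π ((hg.extendedShift hn B hB0 hB ι π N ^ n) z)).1 0) -
      c (activeRow n) ((π ((hg.extendedShift hn B hB0 hB ι π N ^ n) z)).1 0)‖ ≤ 2 * ‖π z‖ := by
  rw [hg.proj_extendedShift_pow hn hB0 hB hπ hN]
  have hle : ∀ k m, ‖c k ((π z).1 m)‖ ≤ ‖π z‖ := fun k m =>
    (hg.norm_coord_le _ _).trans (BigSum.norm_val_le hn _ _)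
  rcases Nat.eq_zero_or_pos n with rfl | hpos
  · refine (norm_sub_le _ _).trans ?_
    have h1 := hle 0 0
    have h2 := hle (activeRow 0) 0
    rw [pow_zero, one_apply_eq_self]
    linarith
  · have h := hg.weightProd_weightedShift_pow B hB0 hB n (π z) 0
    -- `weightProd g c 0` is not the identity: it adds a multiple of `g 1`, which `c 0` and `c k` do
    -- not see when `k ≠ 1`. This fails only at `n = 0`, treated apart.
    have hk : activeRow n ≠ 1 := by
      have := Nat.sqrt_pos.2 hpos
      unfold activeRow
      omega
    set y := ((hg.weightedShift B hB0 hB ^ n) (π z)).1 0 with hy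
    have h1 := hg.coord_sub_coord_blockOp (k := activeRow n) (Nat.succ_ne_zero _) (expansion n)
      ((π z).1 n)
    rw [zero_add] at h
    change c 0 (weightProd g c n _) - c _ (weightProd g c n _) = _ at h1
    rw [← h, weightProd_zero, map_add, map_add, map_smul, map_smul, hg.coord_ne 0 1 zero_ne_one,
      hg.coord_ne _ 1 hk, smul_zero, add_zero, add_zero] at h1
    rw [h1, norm_neg]
    linarith [hle (activeRow n) n, norm_nonneg (π z)]

/-- For small scalings the operator is not `ε`-hypercyclic. -/
theorem not_isEpsHypercyclicFor {ε : ℝ} (hε : ε ∈ Set.Ioo (0 : ℝ) 1) :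
    ∃ t₀ > 0, ∀ t, 0 < t → t ≤ t₀ → ¬ IsEpsHypercyclicFor (scaling (ι ∘L hg.rowProj ∘L π) t)
      (hg.extendedShift hn B hB0 hB ι π N) ε := by
  obtain ⟨ε', hε', hε1⟩ := exists_between hε.2
  set φ : Z →L[𝕜] 𝕜 := c 0 ∘L BigSum.evalCLM hn 0 ∘L π with hφ
  have hφ0 : 0 < ‖φ‖ := by
    rw [norm_pos_iff]
    intro h
    have h1 : φ (ι (BigSum.single 0 (g 0))) = 1 := by
      simp [hφ, hπ, BigSum.evalCLM_apply, BigSum.single_val, hg.coord_self]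
    rw [h] at h1
    simp at h1
  -- A direction nearly norming for `φ`: an approximation of `w` with relative error `ε < ε'` must
  -- keep a definite part of `φ w`.
  obtain ⟨w, hw⟩ : ∃ w, ε' * ‖φ‖ * ‖w‖ < ‖φ w‖ := by
    by_contra! h
    have := φ.opNorm_le_bound (mul_nonneg (hε.1.trans hε').le hφ0.le) h
    nlinarith
  have hw0 : w ≠ 0 := by
    rintro rfl
    simp at hw
  set b := ‖π‖ with hb
  have hb0 : 0 ≤ b := norm_nonneg π
  have hχ : ∀ k z, ‖c k ((π z).1 0)‖ ≤ b * ‖z‖ := fun k z =>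
    ((hg.norm_coord_le _ _).trans (BigSum.norm_val_le hn _ _)).trans (π.le_opNorm z)
  -- Chosen so that `2 * b * t ≤ (ε' - ε) * ‖φ‖`: the contribution of row `k` fits in the gap
  -- between `ε` and `ε'`.
  refine ⟨(ε' - ε) * ‖φ‖ / (2 * b + 1),
    div_pos (mul_pos (sub_pos.2 hε') hφ0) (by positivity), fun t ht htle ⟨x, hx⟩ => ?_⟩
  rw [le_div_iff₀ (by positivity)] at htle
  set S := scaling (ι ∘L hg.rowProj ∘L π) t with hS
  set η := ‖φ w‖ - ε' * ‖φ‖ * ‖w‖ with hη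
  have hη0 : 0 < η := sub_pos.2 hw
  -- The target is so long that the bounded term `2 * ‖π x‖`, coming from the orbit of `x`, cannot
  -- compensate.
  set M : ℝ := (2 * t * ‖π x‖ + 1) / η with hM
  have hM0 : 0 < M := by positivity
  have hP : ∀ z, (ι ∘L hg.rowProj ∘L π) ((ι ∘L hg.rowProj ∘L π) z) = (ι ∘L hg.rowProj ∘L π) z :=
    fun z => by simp [hπ, hg.rowProj_rowProj]
  obtain ⟨y, hy⟩ : ∃ y, S y = (M : 𝕜) • w :=
    ⟨scaling (ι ∘L hg.rowProj ∘L π) t⁻¹ ((M : 𝕜) • w), by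
      rw [hS, scaling_scaling hP, mul_inv_cancel₀ ht.ne', scaling_one]⟩
  have hMw : ‖(M : 𝕜) • w‖ = M * ‖w‖ := by
    rw [norm_smul, RCLike.norm_ofReal, abs_of_pos hM0]
  have hy0 : y ≠ 0 := by
    rintro rfl
    rw [map_zero] at hy
    have := hMw
    rw [← hy, norm_zero] at this
    exact (mul_pos hM0 (norm_pos_iff.2 hw0)).ne this
  obtain ⟨n, hn'⟩ := hx y hy0
  set v := (hg.extendedShift hn B hB0 hB ι π N ^ n) x with hv
  rw [map_sub, hy, hMw] at hn'
  set s := S v - (M : 𝕜) • w with hs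
  have hSv : S v = (M : 𝕜) • w + s := by rw [hs]; abel
  set k := activeRow n with hk
  have hk0 : k ≠ 0 := Nat.succ_ne_zero _
  have h1 : (t : 𝕜) * c 0 ((π v).1 0) = M * φ w + φ s := by
    rw [← hg.coord_zero_scaling hπ t v 0, ← hS]
    change φ (S v) = _
    rw [hSv, map_add, map_smul, smul_eq_mul]
  have h2 : ‖c k ((π v).1 0)‖ ≤ b * (M * ‖w‖ + ‖s‖) := by
    rw [← hg.coord_scaling hπ hk0 t v 0, ← hS]
    refine (hχ k _).trans ?_
    gcongr
    rw [hSv]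
    exact (norm_add_le _ _).trans_eq (by rw [hMw])
  have h3 := hg.norm_coord_sub_coord_le hn hB0 hB hπ hN n x
  rw [← hv, ← hk] at h3
  have h4 : ‖c 0 ((π v).1 0)‖ ≤ 2 * ‖π x‖ + b * (M * ‖w‖ + ‖s‖) := by
    have := norm_sub_norm_le (c 0 ((π v).1 0)) (c k ((π v).1 0))
    linarith
  have h5 : M * ‖φ w‖ ≤ t * ‖c 0 ((π v).1 0)‖ + ‖φ‖ * ‖s‖ := by
    have h6 : (M : 𝕜) * φ w = (t : 𝕜) * c 0 ((π v).1 0) - φ s := by rw [h1]; ring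
    have h7 := norm_sub_le ((t : 𝕜) * c 0 ((π v).1 0)) (φ s)
    rw [← h6, norm_mul, norm_mul, RCLike.norm_ofReal, RCLike.norm_ofReal, abs_of_pos hM0,
      abs_of_pos ht] at h7
    linarith [φ.le_opNorm s]
  have hw1 := norm_nonneg w
  have h8 : ‖φ‖ * ‖s‖ ≤ ‖φ‖ * (ε * (M * ‖w‖)) := by gcongr
  have h9 : t * ‖c 0 ((π v).1 0)‖ ≤ t * (2 * ‖π x‖ + b * (M * ‖w‖ + 1 * (M * ‖w‖))) := by
    gcongr
    refine h4.trans ?_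
    gcongr
    refine hn'.trans ?_
    gcongr
    exact hε.2.le
  have h10 : t * (2 * b) * (M * ‖w‖) ≤ (ε' - ε) * ‖φ‖ * (M * ‖w‖) :=
    mul_le_mul_of_nonneg_right (by linarith) (by positivity)
  have h11 : M * η = 2 * t * ‖π x‖ + 1 := div_mul_cancel₀ _ hη0.ne'
  rw [hη] at h11
  linarith

end

end IsBoundedBiorthogonal

end WeightedShift
end

noncomputable section

/-! ### Approximation for large scalings, and the general criterion. -/

section Criterion

variable {𝕜 : Type*} [RCLike 𝕜] {Y : Type*} [NormedAddCommGroup Y] [NormedSpace 𝕜 Y]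
  [CompleteSpace Y] {f : SchauderBasis 𝕜 Y} {hf : IsUnconditionalBasis 1 f}
  {X : Type*} [NormedAddCommGroup X] [NormedSpace 𝕜 X] {g : ℕ → X} {c : ℕ → X →L[𝕜] 𝕜}
  {Z : Type*} [NormedAddCommGroup Z] [NormedSpace 𝕜 Z]

/-- The vectors `N p + ι y` where `p` and `y` have finitely many non-zero coordinates and the first
coordinate of `p` vanishes. -/
def finiteVectors (c : ℕ → X →L[𝕜] 𝕜) (ι : BigSum f hf X →L[𝕜] Z) (N : X →L[𝕜] Z) :
    Submodule 𝕜 Z where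
  carrier := {z | ∃ (p : X) (y : BigSum f hf X) (m : ℕ), z = N p + ι y ∧ c 0 p = 0 ∧
    (∀ k ≥ m, c k p = 0) ∧ (∀ j ≥ m, y.1 j = 0) ∧ ∀ j, ∀ k ≥ m, c k (y.1 j) = 0}
  zero_mem' := ⟨0, 0, 0, by simp⟩
  add_mem' := by
    rintro _ _ ⟨p, y, m, rfl, hp0, hp, hy, hyc⟩ ⟨p', y', m', rfl, hp0', hp', hy', hyc'⟩
    refine ⟨p + p', y + y', max m m', by simp only [map_add]; abel, by simp [hp0, hp0'],
      fun k hk => ?_, fun j hj => ?_, fun j k hk => ?_⟩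
    · simp [hp k (le_trans (le_max_left _ _) hk), hp' k (le_trans (le_max_right _ _) hk)]
    · simp [hy j (le_trans (le_max_left _ _) hj), hy' j (le_trans (le_max_right _ _) hj)]
    · simp [hyc j k (le_trans (le_max_left _ _) hk), hyc' j k (le_trans (le_max_right _ _) hk)]
  smul_mem' := by
    rintro a _ ⟨p, y, m, rfl, hp0, hp, hy, hyc⟩
    have hval : ∀ j, (a • y).1 j = a • y.1 j := fun _ => rfl
    exact ⟨a • p, a • y, m, by simp, by simp [hp0], fun k hk => by simp [hp k hk],
      fun j hj => by simp [hval, hy j hj], fun j k hk => by simp [hval, hyc j k hk]⟩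

namespace IsBoundedBiorthogonal

variable (hg : IsBoundedBiorthogonal g c)

theorem dense_finiteVectors (hg : IsBoundedBiorthogonal g c) {ι : BigSum f hf X →L[𝕜] Z}
    {π : Z →L[𝕜] BigSum f hf X} {N : X →L[𝕜] Z}
    (hNd : ∀ V : Submodule 𝕜 Z, (∀ r, N (g (r + 1)) ∈ V) →
      ∀ z, z - ι (π z) ∈ V.topologicalClosure) :
    Dense (finiteVectors c ι N : Set Z) := by
  set V := finiteVectors c ι N with hV
  have h1 : ∀ r, N (g (r + 1)) ∈ V := fun r =>
    ⟨g (r + 1), 0, r + 2, by simp, hg.coord_ne _ _ (by omega),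
      fun k hk => hg.coord_ne _ _ (by omega), by simp, by simp⟩
  have h2 : ∀ j i, ι (BigSum.single j (g i)) ∈ V := fun j i => by
    refine ⟨0, BigSum.single j (g i), i + j + 1, by simp, by simp, by simp, fun j' hj => ?_,
      fun j' k hk => ?_⟩
    · rw [BigSum.single_val, Pi.single_eq_of_ne (by omega)]
    · rw [BigSum.single_val]
      rcases eq_or_ne j' j with rfl | h
      · rw [Pi.single_eq_same, hg.coord_ne _ _ (by omega)]
      · rw [Pi.single_eq_of_ne h, map_zero]
  have h3 : ∀ j x, ι (BigSum.single j x) ∈ V.topologicalClosure := fun j x => by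
    refine map_mem_closure (f := fun x => ι (BigSum.single j x)) (by fun_prop)
      (hg.dense_span x) fun x hx => ?_
    have : Submodule.span 𝕜 (Set.range g) ≤ V.comap (ι ∘L BigSum.single j).toLinearMap := by
      rw [Submodule.span_le]
      rintro _ ⟨i, rfl⟩
      exact h2 j i
    exact this hx
  have h4 : ∀ y, ι y ∈ V.topologicalClosure := fun y =>
    V.isClosed_topologicalClosure.mem_of_tendsto ((BigSum.hasSum_single_val y).mapL ι)
      (Eventually.of_forall fun s => Submodule.sum_mem _ fun j _ => h3 j _)
  intro z
  have h5 := V.topologicalClosure.add_mem (hNd V h1 z) (h4 (π z))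
  rwa [sub_add_cancel] at h5

variable (hn : IsNormalizedBasis f) {B : Y →L[𝕜] Y}
  (hB0 : B (f 0) = 0) (hB : ∀ n, B (f (n + 1)) = f n)
  {ι : BigSum f hf X →L[𝕜] Z} {π : Z →L[𝕜] BigSum f hf X} {N : X →L[𝕜] Z}
  (hπ : ∀ x, π (ι x) = x) (hN : ∀ x, π (N x) = 0)

/-- Since `j < q`, the active row at time `j` differs from `q + 1`, so `weightProd g c j` preserves
`c 0 = c (q + 1)` and the contraction of `blockInv` applies. -/
theorem norm_weightProdInv_weightProd_le (hg : IsBoundedBiorthogonal g c) {q i j : ℕ} (hi : i ≤ q)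
    (hj : j < q) {x : X} (hx : c 0 x = c (q + 1) x) :
    ‖weightProdInv g c (q * q + q + i) (weightProd g c j x)‖ ≤
      2 * (1 / 2) ^ (q - i) * (‖weightProd g c j‖ * ‖x‖) := by
  have hne : q + 1 ≠ activeRow j := by
    have := Nat.sqrt_le_self j
    unfold activeRow
    omega
  have h0 : c 0 (weightProd g c j x) = c (q + 1) (weightProd g c j x) := by
    simp only [weightProd, blockOp_apply, map_add, map_smul, hx]
    rw [hg.coord_ne 0 (activeRow j) (Nat.succ_ne_zero _).symm, hg.coord_ne (q + 1) _ hne]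
  rw [weightProdInv, activeRow_window hi]
  refine (hg.norm_blockInv_le_of_eq (expansion_pos _) h0).trans ?_
  gcongr
  · rw [one_div, inv_pow]
    exact inv_anti₀ (by positivity) (expansion_window hi)
  · exact (weightProd g c j).le_opNorm x

include hπ hN

theorem extendedShift_pow_finiteVectors {z : Z} (hz : z ∈ finiteVectors c ι N) :
    ∃ L : ℕ, ∀ n ≥ L, (hg.extendedShift hn B hB0 hB ι π N ^ n) z = 0 := by
  obtain ⟨p, y, m, rfl, -, -, hy, -⟩ := hz
  have h0 : ∀ n ≥ m, ∀ j, ((hg.weightedShift B hB0 hB ^ n) y).1 j = 0 := fun n hnm j =>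
    hg.weightProd_injective j (by
      rw [hg.weightProd_weightedShift_pow, hy _ (by omega), map_zero, map_zero])
  refine ⟨m + 1, fun n hnm => ?_⟩
  obtain ⟨n, rfl⟩ : ∃ n', n = n' + 1 := ⟨n - 1, by omega⟩
  have hzero : (hg.weightedShift B hB0 hB ^ (n + 1)) y = 0 :=
    Subtype.ext (funext fun j => h0 _ (by omega) j)
  rw [hg.extendedShift_pow_succ hn hB0 hB hπ hN, map_add, hN, hπ, zero_add, hzero,
    h0 n (by omega) 0, map_zero, map_zero, add_zero]

/-- The error `e` is row 0 of `π z` moved to row `q + 1`: it has the same norm and is invisible to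
the scaling. -/
theorem extendedShift_approx {z : Z} (hz : z ∈ finiteVectors c ι N) {κ : ℝ} (hκ : 0 < κ) (L : ℕ) :
    ∃ n ≥ L, ∃ u : Z, ‖u‖ < κ ∧ ∃ e : BigSum f hf X,
      (hg.extendedShift hn B hB0 hB ι π N ^ n) u - z = ι e ∧ hg.rowProj e = 0 ∧
        ‖e‖ ≤ ‖hg.rowProj (π z)‖ := by
  obtain ⟨p, y, m, rfl, hp0, hp, hy, hyc⟩ := hz
  set A : ℝ := ∑ l ∈ Finset.range (m + 1), 2 * (‖weightProd g c (l - 1)‖ * (‖p‖ + 2 * ‖y‖)) with hA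
  have hA0 : 0 ≤ A := Finset.sum_nonneg fun l _ => by positivity
  obtain ⟨r, hr⟩ := exists_pow_lt_of_lt_one (show 0 < κ / (‖ι‖ * A + 1) by positivity)
    (one_half_lt_one (α := ℝ))
  rw [lt_div_iff₀ (by positivity)] at hr
  -- Large enough for row `q + 1` to avoid all supports, for the window to hold all entries, for `q
  -- - l ≥ r` when `l ≤ m`, and for the time to exceed `L`.
  set q := m + r + L + 1 with hq
  set a := q * q + q with ha
  -- The vectors to be lifted: slot `0` is `p`, slot `j + 1` is `y j` corrected so that rows 0 and
  -- `q + 1` agree.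
  set x : ℕ → X := fun l => Nat.casesOn l p fun j => y.1 j + c 0 (y.1 j) • g (q + 1) with hx
  have hxs : ∀ j, x (j + 1) = y.1 j + c 0 (y.1 j) • g (q + 1) := fun _ => rfl
  have hxc : ∀ l, c 0 (x l) = c (q + 1) (x l) := by
    rintro (_ | j)
    · exact hp0.trans (hp _ (by omega)).symm
    · rw [hxs, map_add, map_add, map_smul, map_smul, hg.coord_self,
        hg.coord_ne 0 _ (Nat.succ_ne_zero q).symm, hyc j (q + 1) (by omega)]
      simp
  have hxn : ∀ l, ‖x l‖ ≤ ‖p‖ + 2 * ‖y‖ := by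
    rintro (_ | j)
    · change ‖p‖ ≤ _
      linarith [norm_nonneg y]
    · rw [hxs]
      refine (norm_add_le _ _).trans ?_
      rw [hg.norm_smul_vec]
      linarith [hg.norm_coord_le 0 (y.1 j), BigSum.norm_val_le hn y j, norm_nonneg p]
  -- Slot `0` reaches entry 0 at time `a`, and slot `j + 1` reaches entry `j` at time `a + 1`.
  -- Truncated subtraction gives the right product index `0` in both slots `0` and `1`.
  set W : ℕ → X := fun l => weightProdInv g c (a + l) (weightProd g c (l - 1) (x l)) with hW
  set w : BigSum f hf X := ∑ l ∈ Finset.range (m + 1), BigSum.single (a + l) (W l) with hw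
  have hwv : ∀ l, w.1 (a + l) = W l := fun l => by
    have h1 : w.1 (a + l) = if l ∈ Finset.range (m + 1) then W l else 0 := by
      have h2 := map_sum (BigSum.valₗ (𝕜 := 𝕜) (f := f) (hf := hf) (X := X) (a + l))
        (fun l => BigSum.single (a + l) (W l)) (Finset.range (m + 1))
      refine h2.trans ?_
      rw [← Finset.sum_ite_eq]
      refine Finset.sum_congr rfl fun i _ => ?_
      change (Pi.single (a + i) (W i) : ℕ → X) (a + l) = _
      by_cases hil : l = i
      · subst hil; simp
      · rw [Pi.single_eq_of_ne (by omega), if_neg hil]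
    rw [h1]
    split_ifs with h
    · rfl
    · rw [Finset.mem_range, not_lt] at h
      obtain ⟨j, rfl⟩ : ∃ j, l = j + 1 := ⟨l - 1, by omega⟩
      simp only [hW, hxs, hy j (by omega)]
      simp
  have hprod : ∀ l, weightProd g c (a + l) (w.1 (a + l)) = weightProd g c (l - 1) (x l) :=
    fun l => by rw [hwv, hW, hg.weightProd_weightProdInv]
  have hwn : ‖w‖ ≤ (1 / 2) ^ r * A := by
    rw [hA, Finset.mul_sum]
    refine (norm_sum_le _ _).trans (Finset.sum_le_sum fun l hl => ?_)
    have hlm : l ≤ m := Nat.lt_succ_iff.1 (Finset.mem_range.1 hl)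
    refine ((BigSum.norm_single_le hn _ _).trans
      (hg.norm_weightProdInv_weightProd_le (by omega) (by omega) (hxc l))).trans ?_
    have h1 : ((1 : ℝ) / 2) ^ (q - l) ≤ (1 / 2) ^ r :=
      pow_le_pow_of_le_one (by norm_num) (by norm_num) (by omega)
    calc 2 * (1 / 2 : ℝ) ^ (q - l) * (‖weightProd g c (l - 1)‖ * ‖x l‖)
        ≤ 2 * (1 / 2) ^ r * (‖weightProd g c (l - 1)‖ * (‖p‖ + 2 * ‖y‖)) := by
          gcongr
          exact hxn l
      _ = _ := by ring
  refine ⟨a + 1, by omega, ι w, ?_, (hg.weightedShift B hB0 hB ^ (a + 1)) w - y, ?_, ?_, ?_⟩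
  · calc ‖ι w‖ ≤ ‖ι‖ * ((1 / 2) ^ r * A) := (ι.le_opNorm w).trans (by gcongr)
      _ = (1 / 2) ^ r * (‖ι‖ * A) := by ring
      _ ≤ (1 / 2) ^ r * (‖ι‖ * A + 1) := by gcongr; linarith
      _ < κ := hr
  all_goals
    have hval : ∀ j, ((hg.weightedShift B hB0 hB ^ (a + 1)) w).1 j =
        y.1 j + c 0 (y.1 j) • g (q + 1) := fun j => hg.weightProd_injective j (by
      rw [hg.weightProd_weightedShift_pow, show j + (a + 1) = a + (j + 1) by ring, hprod, hxs,
        Nat.add_sub_cancel])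
  · have h0 : ((hg.weightedShift B hB0 hB ^ a) w).1 0 = p := hg.weightProd_injective 0 (by
      rw [hg.weightProd_weightedShift_pow, show 0 + a = a + 0 by ring, hprod]
      rfl)
    rw [hg.extendedShift_pow_succ hn hB0 hB hπ hN, hπ, h0, map_sub]
    abel
  · refine Subtype.ext (funext fun j => ?_)
    change (hg.rowProj _).1 j = 0
    rw [rowProj_val, BigSum.sub_val, hval, add_sub_cancel_left, map_smul,
      hg.coord_ne 0 _ (Nat.succ_ne_zero q).symm, smul_zero, zero_smul]
  · rw [map_add, hN, hπ, zero_add]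
    refine BigSum.norm_le_of_forall_le fun j => ?_
    rw [rowProj_val, BigSum.sub_val, hval, add_sub_cancel_left, hg.norm_smul_vec, hg.norm_smul_vec]

/-- For large scalings the operator is `ε`-hypercyclic. -/
theorem isEpsHypercyclicFor [CompleteSpace Z] [TopologicalSpace.SeparableSpace Z]
    (hNd : ∀ V : Submodule 𝕜 Z, (∀ r, N (g (r + 1)) ∈ V) →
      ∀ z, z - ι (π z) ∈ V.topologicalClosure) {ε : ℝ} (hε : 0 < ε) :
    ∃ t > 0, IsEpsHypercyclicFor (scaling (ι ∘L hg.rowProj ∘L π) t)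
      (hg.extendedShift hn B hB0 hB ι π N) ε := by
  set C := ‖ι‖ * ‖hg.rowProj ∘L π‖ with hC
  have hC0 : 0 ≤ C := by positivity
  -- Gives `C / t < ε`, the relative size of the error being at most `C / t`.
  set t := (C + 1) / ε with ht
  have ht0 : 0 < t := by positivity
  have hP : ∀ z, (ι ∘L hg.rowProj ∘L π) ((ι ∘L hg.rowProj ∘L π) z) = (ι ∘L hg.rowProj ∘L π) z :=
    fun z => by simp [hπ, hg.rowProj_rowProj]
  refine ⟨t, ht0, isEpsHypercyclicFor_of_dense (S' := scaling (ι ∘L hg.rowProj ∘L π) t⁻¹)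
    (γ := C / t) (fun z => by rw [scaling_scaling hP, inv_mul_cancel₀ ht0.ne', scaling_one]) ?_
    (hg.dense_finiteVectors hNd)
    (fun z hz => hg.extendedShift_pow_finiteVectors hn hB0 hB hπ hN hz) fun z hz κ hκ L => ?_⟩
  · rw [div_lt_iff₀ ht0, ht, mul_div_cancel₀ _ hε.ne']
    linarith
  · obtain ⟨n, hnL, u, hu, e, he, he0, hen⟩ :=
      hg.extendedShift_approx hn hB0 hB hπ hN hz hκ L
    refine ⟨n, hnL, u, hu, ?_⟩
    have h1 : scaling (ι ∘L hg.rowProj ∘L π) t (ι e) = ι e := by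
      simp [scaling_apply, hπ, he0]
    have h2 : hg.rowProj (π (scaling (ι ∘L hg.rowProj ∘L π) t z)) = (t : 𝕜) • hg.rowProj (π z) := by
      have : π (scaling (ι ∘L hg.rowProj ∘L π) t z) =
          π z + ((t - 1 : ℝ) : 𝕜) • hg.rowProj (π z) := by
        simp [scaling_apply, hπ]
      rw [this, map_add, map_smul, hg.rowProj_rowProj]
      push_cast
      module
    have h3 : t * ‖hg.rowProj (π z)‖ ≤
        ‖hg.rowProj ∘L π‖ * ‖scaling (ι ∘L hg.rowProj ∘L π) t z‖ := by
      have := (hg.rowProj ∘L π).le_opNorm (scaling (ι ∘L hg.rowProj ∘L π) t z)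
      rw [ContinuousLinearMap.comp_apply, h2, norm_smul, RCLike.norm_ofReal, abs_of_pos ht0] at this
      exact this
    rw [he, h1, div_mul_eq_mul_div, le_div_iff₀ ht0]
    calc ‖ι e‖ * t ≤ ‖ι‖ * ‖hg.rowProj (π z)‖ * t := by
          gcongr
          exact (ι.le_opNorm e).trans (by gcongr)
      _ = ‖ι‖ * (t * ‖hg.rowProj (π z)‖) := by ring
      _ ≤ ‖ι‖ * (‖hg.rowProj ∘L π‖ * ‖scaling (ι ∘L hg.rowProj ∘L π) t z‖) := by gcongr
      _ = _ := by ring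

end IsBoundedBiorthogonal

theorem IsBoundedBiorthogonal.everyEpsIsThreshold [CompleteSpace Z]
    [TopologicalSpace.SeparableSpace Z] (hg : IsBoundedBiorthogonal g c)
    (hn : IsNormalizedBasis f) {B : Y →L[𝕜] Y} (hB0 : B (f 0) = 0) (hB : ∀ n, B (f (n + 1)) = f n)
    {ι : BigSum f hf X →L[𝕜] Z} {π : Z →L[𝕜] BigSum f hf X} (hπ : ∀ x, π (ι x) = x) :
    EveryEpsIsThreshold 𝕜 Z := by
  obtain ⟨N, hN, hNd⟩ := hg.exists_operator_dense_ker ι π hπ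
  exact everyEpsIsThreshold_of_scaling (P := ι ∘L hg.rowProj ∘L π)
    (T := hg.extendedShift hn B hB0 hB ι π N) (fun z => by simp [hπ, hg.rowProj_rowProj])
    (fun ε hε => hg.not_isEpsHypercyclicFor hn hB0 hB hπ hN hε)
    fun ε hε => hg.isEpsHypercyclicFor hn hB0 hB hπ hN hNd hε

/-- 1-unconditionality bounds a single term of an expansion by its partial sums, hence the
normalized coordinates by the norm. -/
theorem IsUnconditionalBasis.isBoundedBiorthogonal {e : SchauderBasis 𝕜 X}
    (he : IsUnconditionalBasis 1 e) :
    IsBoundedBiorthogonal (fun n => ((‖e n‖⁻¹ : ℝ) : 𝕜) • e n)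
      fun n => ((‖e n‖ : ℝ) : 𝕜) • e.coord n := by
  have hne : ∀ n, ‖e n‖ ≠ 0 := fun n h => by
    have := e.ortho n n
    rw [norm_eq_zero.1 h] at this
    simp at this
  have hne' : ∀ n, ((‖e n‖ : ℝ) : 𝕜) ≠ 0 := fun n => by exact_mod_cast hne n
  refine ⟨fun i => ?_, fun i j hij => ?_, fun i => ?_, fun i x => ?_, ?_⟩
  · simp [e.ortho, hne' i]
  · simp [e.ortho, hij]
  · rw [norm_smul, RCLike.norm_ofReal, abs_of_nonneg (by positivity), inv_mul_cancel₀ (hne i)]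
  · have h := (SchauderBasis.tendsto_proj e x).norm
    refine ge_of_tendsto h ?_
    filter_upwards [eventually_gt_atTop i] with N hN
    have h1 := he.norm_sum_le (Finset.range N) (fun n => e.coord n x)
      (fun n => if n = i then e.coord n x else 0) (fun n _ => by split_ifs <;> simp)
    rw [Finset.sum_eq_single i (by intro n _ hn; simp [hn])
      (by intro h; exact absurd (Finset.mem_range.2 hN) h)] at h1
    rw [SchauderBasis.proj_apply]
    simpa [norm_smul, mul_comm] using h1
  · intro x
    refine mem_closure_of_tendsto (SchauderBasis.tendsto_proj e x)
      (Eventually.of_forall fun N => ?_)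
    rw [SchauderBasis.proj_apply]
    refine Submodule.sum_mem _ fun n _ => Submodule.smul_mem _ _ ?_
    have h1 : e n = ((‖e n‖ : ℝ) : 𝕜) • ((‖e n‖⁻¹ : ℝ) : 𝕜) • e n := by
      rw [smul_smul]
      push_cast
      rw [mul_inv_cancel₀ (hne' n), one_smul]
    rw [h1]
    exact Submodule.smul_mem _ _ (Submodule.subset_span ⟨n, rfl⟩)

theorem ContainsComplementedCopy.exists_retraction {E : Type*} [NormedAddCommGroup E]
    [NormedSpace 𝕜 E] (h : ContainsComplementedCopy 𝕜 Z E) :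
    ∃ (ι : E →L[𝕜] Z) (π : Z →L[𝕜] E), ∀ x, π (ι x) = x := by
  obtain ⟨V, ⟨p, hp⟩, ⟨φ⟩⟩ := h
  exact ⟨V.subtypeL ∘L φ.toContinuousLinearMap, φ.symm.toContinuousLinearMap ∘L p, fun x => by
    simp [hp]⟩

theorem ContainsComplementedBigSum.everyEpsIsThreshold [CompleteSpace Z]
    [TopologicalSpace.SeparableSpace Z] (h : ContainsComplementedBigSum 𝕜 Z X Y) :
    EveryEpsIsThreshold 𝕜 Z := by
  obtain ⟨⟨e, he⟩, f, hf, hn, ⟨B, hB0, hB⟩, hc⟩ := h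
  obtain ⟨ι, π, hπ⟩ := hc.exists_retraction
  exact he.isBoundedBiorthogonal.everyEpsIsThreshold hn hB0 hB hπ

end Criterion
end

noncomputable section

/-! ### Spaces isometric to the sum of copies of themselves. -/

section SelfSum

variable {𝕜 : Type*} [RCLike 𝕜] {E : Type*} [NormedAddCommGroup E] [NormedSpace 𝕜 E]

/-- The norm of `E` is a lattice norm for the normalized basis `e`, the backward shift is a
contraction, and `E` is the `E`-sum of copies of itself. -/
structure IsSelfSummingBasis (e : SchauderBasis 𝕜 E) : Prop where
  norm_basis : IsNormalizedBasis e
  norm_mono : ∀ x y, (∀ n, ‖e.coord n x‖ ≤ ‖e.coord n y‖) → ‖x‖ ≤ ‖y‖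
  exists_shift : ∀ x, ∃ y, (∀ n, e.coord n y = e.coord (n + 1) x) ∧ ‖y‖ ≤ ‖x‖
  exists_rows : ∀ x, ∃ (r : ℕ → E) (s : E), (∀ n m, e.coord m (r n) = e.coord (Nat.pair n m) x) ∧
    (∀ n, e.coord n s = ((‖r n‖ : ℝ) : 𝕜)) ∧ ‖s‖ = ‖x‖
  exists_of_rows : ∀ (r : ℕ → E) (s : E), (∀ n, e.coord n s = ((‖r n‖ : ℝ) : 𝕜)) →
    ∃ x, ∀ n m, e.coord (Nat.pair n m) x = e.coord m (r n)

theorem SchauderBasis.ext_coord (e : SchauderBasis 𝕜 E) {x y : E}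
    (h : ∀ n, e.coord n x = e.coord n y) : x = y :=
  tendsto_nhds_unique (SchauderBasis.tendsto_proj e x) (by
    simpa only [SchauderBasis.proj_apply, h] using SchauderBasis.tendsto_proj e y)

theorem SchauderBasis.coord_sum_range (e : SchauderBasis 𝕜 E) (a : ℕ → 𝕜) (N n : ℕ) :
    e.coord n (∑ i ∈ Finset.range N, a i • e i) = if n < N then a n else 0 := by
  simp [e.ortho, Pi.single_apply]

theorem SchauderBasis.coord_of_hasSum (e : SchauderBasis 𝕜 E) {a : ℕ → 𝕜} {s : E} (hs : HasSum (fun n => a n • e n) s) (n : ℕ) :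
    e.coord n s = a n := by
  refine (hs.mapL (e.coord n)).unique ?_
  convert hasSum_single n _ using 1
  · simp [e.ortho]
  · intro m hm
    simp [e.ortho, hm.symm]

namespace IsSelfSummingBasis

variable {e : SchauderBasis 𝕜 E} (h : IsSelfSummingBasis e)

include h

theorem isUnconditionalBasis : IsUnconditionalBasis 1 e := by
  intro N a b hab
  rw [one_mul]
  refine h.norm_mono _ _ fun n => ?_
  rw [SchauderBasis.coord_sum_range, SchauderBasis.coord_sum_range]
  split_ifs with hn
  · exact hab n (Finset.mem_range.2 hn)
  · rfl

theorem hasContinuousBackwardShift : HasContinuousBackwardShift e := by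
  choose B hB hBn using h.exists_shift
  refine ⟨LinearMap.mkContinuous { toFun := B, map_add' := fun x y => ?_, map_smul' := fun a x => ?_ }
    1 fun x => by simpa using hBn x, ?_, fun n => ?_⟩
  · exact SchauderBasis.ext_coord e fun n => by simp [hB]
  · exact SchauderBasis.ext_coord e fun n => by simp [hB]
  · exact SchauderBasis.ext_coord e fun n => by simp [hB, e.ortho]
  · exact SchauderBasis.ext_coord e fun m => by simp [hB, e.ortho, Pi.single_apply]

theorem hasSum_of_coord [CompleteSpace E] {a : ℕ → 𝕜} {s : E} (hs : ∀ n, e.coord n s = a n) :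
    HasSum (fun n => a n • e n) s := by
  have h1 : Tendsto (fun N => ∑ n ∈ Finset.range N, a n • e n) atTop (𝓝 s) := by
    simpa only [SchauderBasis.proj_apply, hs] using SchauderBasis.tendsto_proj e s
  have h2 := (h.isUnconditionalBasis.summable_iff a).2 ⟨s, h1⟩
  rw [← tendsto_nhds_unique h2.hasSum.tendsto_sum_nat h1]
  exact h2.hasSum

/-- `Nat.pair` arranges the coordinates of a vector into rows; by `exists_rows` this is isometric,
and by `exists_of_rows` it is onto. -/
theorem nonempty_bigSum_equiv [CompleteSpace E] :
    Nonempty (BigSum e h.isUnconditionalBasis E ≃L[𝕜] E) := by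
  choose r s hr hs hsn using h.exists_rows
  have hsum : ∀ x, HasSum (fun n => ((‖r x n‖ : ℝ) : 𝕜) • e n) (s x) := fun x =>
    h.hasSum_of_coord (hs x)
  set F : ℕ → E →ₗ[𝕜] E := fun n =>
    { toFun := fun x => r x n
      map_add' := fun x y => SchauderBasis.ext_coord e fun m => by simp [hr]
      map_smul' := fun a x => SchauderBasis.ext_coord e fun m => by simp [hr] } with hF
  set Φ : E →L[𝕜] BigSum e h.isUnconditionalBasis E :=
    BigSum.liftCLM F 1 (fun x => (hsum x).summable) fun x => by
      rw [one_mul, ← hsn x, ← (hsum x).tsum_eq]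
      rfl with hΦ
  have hnorm : ∀ x, ‖Φ x‖ = ‖x‖ := fun x => by
    rw [← hsn x, ← (hsum x).tsum_eq]
    rfl
  have hsurj : Function.Surjective Φ := fun y => by
    obtain ⟨x, hx⟩ := h.exists_of_rows y.1 _ (SchauderBasis.coord_of_hasSum e y.summable_norm.hasSum)
    refine ⟨x, Subtype.ext (funext fun n => SchauderBasis.ext_coord e fun m => ?_)⟩
    exact (hr x n m).trans (hx n m)
  exact ⟨(LinearIsometryEquiv.ofSurjective ⟨Φ.toLinearMap, hnorm⟩ hsurj).symm.toContinuousLinearEquiv⟩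

theorem containsComplementedBigSum [CompleteSpace E] {Z : Type*} [NormedAddCommGroup Z]
    [NormedSpace 𝕜 Z] (hZ : ContainsComplementedCopy 𝕜 Z E) :
    ContainsComplementedBigSum 𝕜 Z E E := by
  obtain ⟨V, hV, ⟨φ⟩⟩ := hZ
  obtain ⟨ψ⟩ := h.nonempty_bigSum_equiv
  exact ⟨⟨e, h.isUnconditionalBasis⟩, e, h.isUnconditionalBasis, h.norm_basis,
    h.hasContinuousBackwardShift, V, hV, ⟨ψ.trans φ⟩⟩

end IsSelfSummingBasis

end SelfSum

/-! ### The spaces `ℓᵖ`. -/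

section Lp

variable (𝕜 : Type*) [RCLike 𝕜]

/-- The canonical basis of `ℓᵖ`. -/
def lpBasis {p : ENNReal} [Fact (1 ≤ p)] (hp : p ≠ ⊤) : SchauderBasis 𝕜 (lp (fun _ : ℕ => 𝕜) p) where
  basis n := lp.single p n 1
  coord n := lp.evalCLM 𝕜 (fun _ : ℕ => 𝕜) p n
  ortho i j := by
    change (Pi.single j (1 : 𝕜) : ℕ → 𝕜) i = _
    simp [Pi.single_apply]
  expansion x := by
    have h := (lp.hasSum_single hp x).tendsto_sum_nat
    rw [HasSum, SummationFilter.conditional_filter_eq_map_range, tendsto_map'_iff]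
    refine h.congr fun N => Finset.sum_congr rfl fun n _ => ?_
    rw [← lp.single_smul, smul_eq_mul, mul_one]
    rfl

theorem isSelfSummingBasis_lpBasis {p : ENNReal} [Fact (1 ≤ p)] (hp : p ≠ ⊤) :
    IsSelfSummingBasis (lpBasis 𝕜 hp) := by
  have hp0 : 0 < p := zero_lt_one.trans_le Fact.out
  have hp' : 0 < p.toReal := ENNReal.toReal_pos hp0.ne' hp
  have hcoord : ∀ n (x : lp (fun _ : ℕ => 𝕜) p), (lpBasis 𝕜 hp).coord n x = x n := fun _ _ => rfl
  have hnn : ∀ a : 𝕜, 0 ≤ ‖a‖ ^ p.toReal := fun a => by positivity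
  have hle : ∀ x y : lp (fun _ : ℕ => 𝕜) p, ‖x‖ ^ p.toReal ≤ ‖y‖ ^ p.toReal → ‖x‖ ≤ ‖y‖ :=
    fun x y h => (Real.rpow_le_rpow_iff (norm_nonneg _) (norm_nonneg _) hp').1 h
  have hsum : ∀ x : lp (fun _ : ℕ => 𝕜) p, HasSum (fun n => ‖x n‖ ^ p.toReal) (‖x‖ ^ p.toReal) :=
    fun x => lp.hasSum_norm hp' x
  have hmem : ∀ a : ℕ → 𝕜, (Summable fun n => ‖a n‖ ^ p.toReal) →
      ∃ x : lp (fun _ : ℕ => 𝕜) p, ∀ n, x n = a n := fun a ha =>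
    ⟨⟨a, (memℓp_gen_iff hp').2 ha⟩, fun _ => rfl⟩
  have hinj : ∀ n, Function.Injective (Nat.pair n) := fun n m m' hm =>
    (Nat.pair_eq_pair.1 hm).2
  refine ⟨fun n => ?_, fun x y hxy => ?_, fun x => ?_, fun x => ?_, fun r s hrs => ?_⟩
  · exact (lp.norm_single (E := fun _ : ℕ => 𝕜) hp0 n (1 : 𝕜)).trans norm_one
  · refine hle x y (hasSum_le (fun n => ?_) (hsum x) (hsum y))
    exact Real.rpow_le_rpow (norm_nonneg _) (hxy n) hp'.le
  · have h1 : Summable fun n => ‖x (n + 1)‖ ^ p.toReal :=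
      (summable_nat_add_iff (f := fun n => ‖x n‖ ^ p.toReal) 1).2 (hsum x).summable
    obtain ⟨y, hy⟩ := hmem (fun n => x (n + 1)) h1
    refine ⟨y, fun n => by rw [hcoord, hcoord, hy], hle y x ?_⟩
    refine hasSum_le_inj (fun n => n + 1) (add_left_injective 1) (fun n _ => hnn _) (fun n => ?_)
      (hsum y) (hsum x)
    rw [hy]
  · choose r hr using fun n => hmem (fun m => x (Nat.pair n m))
      ((hsum x).summable.comp_injective (hinj n))
    -- Summing the `p`-th powers row by row gives `‖s‖ = ‖x‖`.
    have h1 : HasSum (fun q : ℕ × ℕ => ‖x (Nat.pair q.1 q.2)‖ ^ p.toReal) (‖x‖ ^ p.toReal) :=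
      (Nat.pairEquiv.hasSum_iff (f := fun n => ‖x n‖ ^ p.toReal)).2 (hsum x)
    have h2 : HasSum (fun n => ‖((‖r n‖ : ℝ) : 𝕜)‖ ^ p.toReal) (‖x‖ ^ p.toReal) := by
      refine h1.prod_fiberwise fun n => ?_
      have := hsum (r n)
      simp only [hr] at this
      simpa using this
    obtain ⟨s, hs⟩ := hmem _ h2.summable
    refine ⟨r, s, hr, hs, le_antisymm (hle s x ?_) (hle x s ?_)⟩
    · have := hsum s
      simp only [hs] at this
      exact (this.unique h2).le
    · have := hsum s
      simp only [hs] at this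
      exact (h2.unique this).le
  · have h1 : Summable fun q : ℕ × ℕ => ‖r q.1 q.2‖ ^ p.toReal := by
      refine (summable_prod_of_nonneg fun q => hnn _).2
        ⟨fun n => (hsum (r n)).summable, ?_⟩
      have h2 := (hsum s).summable
      refine h2.congr fun n => ?_
      have h3 : s n = ((‖r n‖ : ℝ) : 𝕜) := hrs n
      rw [(hsum (r n)).tsum_eq, h3]
      simp
    obtain ⟨x, hx⟩ := hmem (fun k => r k.unpair.1 k.unpair.2)
      ((Nat.pairEquiv.symm.summable_iff (f := fun q : ℕ × ℕ => ‖r q.1 q.2‖ ^ p.toReal)).2 h1)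
    exact ⟨x, fun n m => by rw [hcoord, hcoord, hx, Nat.unpair_pair]⟩

end Lp

/-! ### The space `c₀`. -/

section CZero

open scoped ZeroAtInfty

variable (𝕜 : Type*) [RCLike 𝕜]

theorem ZeroAtInftyContinuousMap.norm_le_iff {x : C₀(ℕ, 𝕜)} {M : ℝ} (hM : 0 ≤ M) :
    ‖x‖ ≤ M ↔ ∀ n, ‖x n‖ ≤ M := by
  rw [← ZeroAtInftyContinuousMap.norm_toBCF_eq_norm, BoundedContinuousFunction.norm_le hM]
  rfl

theorem ZeroAtInftyContinuousMap.norm_coe_le (x : C₀(ℕ, 𝕜)) (n : ℕ) : ‖x n‖ ≤ ‖x‖ :=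
  (ZeroAtInftyContinuousMap.norm_le_iff 𝕜 (norm_nonneg x)).1 le_rfl n

/-- The element of `c₀` with given coordinates. -/
def zeroAtInftyOfFinite (a : ℕ → 𝕜) (ha : ∀ ε > 0, {n | ε ≤ ‖a n‖}.Finite) : C₀(ℕ, 𝕜) where
  toFun := a
  continuous_toFun := continuous_of_discreteTopology
  zero_at_infty' := by
    rw [Filter.cocompact_eq_cofinite, Metric.tendsto_nhds]
    intro ε hε
    refine (ha ε hε).subset fun n hn => ?_
    simpa using hn

theorem finite_setOf_le_norm (x : C₀(ℕ, 𝕜)) {ε : ℝ} (hε : 0 < ε) : {n | ε ≤ ‖x n‖}.Finite := by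
  have h := x.zero_at_infty'
  rw [Filter.cocompact_eq_cofinite, Metric.tendsto_nhds] at h
  refine (h ε hε).subset fun n hn => ?_
  simpa using hn

/-- The evaluation functionals on `c₀`. -/
def zeroAtInftyEval (n : ℕ) : C₀(ℕ, 𝕜) →L[𝕜] 𝕜 :=
  LinearMap.mkContinuous
    { toFun := fun x => x n, map_add' := fun _ _ => rfl, map_smul' := fun _ _ => rfl } 1
    fun x => by
      rw [one_mul]
      exact ZeroAtInftyContinuousMap.norm_coe_le 𝕜 x n

theorem finite_setOf_le_norm_single (n : ℕ) (ε : ℝ) (hε : ε > 0) :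
    {m | ε ≤ ‖(Pi.single n (1 : 𝕜) : ℕ → 𝕜) m‖}.Finite :=
  (Set.finite_singleton n).subset fun m hm => by
    by_contra hne
    rw [Set.mem_ofPred_eq, Pi.single_eq_of_ne hne, norm_zero] at hm
    exact absurd hε (not_lt.2 hm)

/-- The canonical basis of `c₀`. -/
def zeroAtInftyBasis : SchauderBasis 𝕜 C₀(ℕ, 𝕜) where
  basis n := zeroAtInftyOfFinite 𝕜 (Pi.single n 1) (finite_setOf_le_norm_single 𝕜 n)
  coord := zeroAtInftyEval 𝕜
  ortho i j := by
    change (Pi.single j (1 : 𝕜) : ℕ → 𝕜) i = _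
    simp [Pi.single_apply]
  expansion x := by
    rw [HasSum, SummationFilter.conditional_filter_eq_map_range, tendsto_map'_iff,
      Metric.tendsto_atTop]
    intro ε hε
    obtain ⟨N, hN⟩ := (finite_setOf_le_norm 𝕜 x (half_pos hε)).bddAbove
    refine ⟨N + 1, fun M hM => ?_⟩
    rw [dist_eq_norm]
    refine lt_of_le_of_lt ((ZeroAtInftyContinuousMap.norm_le_iff 𝕜 (half_pos hε).le).2
      fun n => ?_) (half_lt_self hε)
    rw [ZeroAtInftyContinuousMap.sub_apply]
    have h1 (y : ℕ → C₀(ℕ, 𝕜)) :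
        (∑ k ∈ Finset.range M, y k) n = ∑ k ∈ Finset.range M, y k n :=
      map_sum (zeroAtInftyEval 𝕜 n) y _
    have h2 (k : ℕ) : (zeroAtInftyEval 𝕜 k x • zeroAtInftyOfFinite 𝕜 (Pi.single k 1)
        (finite_setOf_le_norm_single 𝕜 k)) n = if n = k then x k else 0 := by
      change x k * (Pi.single k (1 : 𝕜) : ℕ → 𝕜) n = _
      simp [Pi.single_apply]
    simp only [Function.comp_apply, h1, h2, Finset.sum_ite_eq, Finset.mem_range]
    split_ifs with h3
    · simpa using (half_pos hε).le
    · rw [zero_sub, norm_neg]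
      by_contra hlt
      have := hN (show n ∈ {n | ε / 2 ≤ ‖x n‖} from (not_le.1 hlt).le)
      omega

theorem isSelfSummingBasis_zeroAtInftyBasis : IsSelfSummingBasis (zeroAtInftyBasis 𝕜) := by
  have hcoord : ∀ n (x : C₀(ℕ, 𝕜)), (zeroAtInftyBasis 𝕜).coord n x = x n := fun _ _ => rfl
  have hle : ∀ x y : C₀(ℕ, 𝕜), (∀ n, ‖x n‖ ≤ ‖y‖) → ‖x‖ ≤ ‖y‖ := fun x y h =>
    (ZeroAtInftyContinuousMap.norm_le_iff 𝕜 (norm_nonneg y)).2 h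
  have hn : ∀ (x : C₀(ℕ, 𝕜)) n, ‖x n‖ ≤ ‖x‖ := ZeroAtInftyContinuousMap.norm_coe_le 𝕜
  have hmem : ∀ a : ℕ → 𝕜, (∀ ε > 0, {n | ε ≤ ‖a n‖}.Finite) → ∃ x : C₀(ℕ, 𝕜), ∀ n, x n = a n :=
    fun a ha => ⟨zeroAtInftyOfFinite 𝕜 a ha, fun _ => rfl⟩
  have hcomp : ∀ (x : C₀(ℕ, 𝕜)) (σ : ℕ → ℕ), Function.Injective σ →
      ∃ y : C₀(ℕ, 𝕜), ∀ n, y n = x (σ n) := fun x σ hσ =>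
    hmem _ fun ε hε => Set.Finite.preimage (f := σ) hσ.injOn (finite_setOf_le_norm 𝕜 x hε)
  refine ⟨fun n => le_antisymm ?_ ?_, fun x y hxy => ?_, fun x => ?_, fun x => ?_, fun r s hrs => ?_⟩
  · refine (ZeroAtInftyContinuousMap.norm_le_iff 𝕜 zero_le_one).2 fun m => ?_
    change ‖(Pi.single n (1 : 𝕜) : ℕ → 𝕜) m‖ ≤ 1
    rcases eq_or_ne m n with rfl | h
    · simp
    · simp [h]
  · have := hn (zeroAtInftyBasis 𝕜 n) n
    change ‖(Pi.single n (1 : 𝕜) : ℕ → 𝕜) n‖ ≤ _ at this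
    simpa using this
  · exact hle x y fun n => (hxy n).trans (hn y n)
  · obtain ⟨y, hy⟩ := hcomp x (· + 1) (add_left_injective 1)
    exact ⟨y, hy, hle y x fun n => by rw [hy]; exact hn x _⟩
  · choose r hr using fun n => hcomp x (Nat.pair n) fun m m' hm => (Nat.pair_eq_pair.1 hm).2
    obtain ⟨s, hs⟩ := hmem (fun n => ((‖r n‖ : ℝ) : 𝕜)) fun ε hε => by
      -- A row of norm at least `ε` has an entry larger than `ε / 2`, and `x` has finitely many of
      -- these.
      refine ((finite_setOf_le_norm 𝕜 x (half_pos hε)).image fun k => k.unpair.1).subset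
        fun n hnε => ?_
      by_contra hne
      have : ‖r n‖ ≤ ε / 2 := (ZeroAtInftyContinuousMap.norm_le_iff 𝕜 (half_pos hε).le).2
        fun m => by
          by_contra hlt
          refine hne ⟨Nat.pair n m, ?_, by simp⟩
          rw [Set.mem_ofPred_eq, ← hr]
          exact (not_le.1 hlt).le
      rw [Set.mem_ofPred_eq, RCLike.norm_ofReal, abs_norm] at hnε
      linarith
    have hs' : ∀ n, ‖s n‖ = ‖r n‖ := fun n => by rw [hs, RCLike.norm_ofReal, abs_norm]
    refine ⟨r, s, hr, hs, le_antisymm (hle s x fun n => ?_) (hle x s fun k => ?_)⟩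
    · rw [hs']
      exact hle _ _ fun m => by rw [hr]; exact hn x _
    · rw [← Nat.pair_unpair k, ← hr]
      exact (hn _ _).trans ((hs' _).symm.trans_le (hn s _))
  · obtain ⟨x, hx⟩ := hmem (fun k => r k.unpair.1 k.unpair.2) fun ε hε => by
      -- Only the finitely many rows of norm at least `ε` can contain an entry of size at least `ε`.
      have h1 : (⋃ n ∈ {n | ε ≤ ‖s n‖}, Nat.pair n '' {m | ε ≤ ‖r n m‖}).Finite :=
        (finite_setOf_le_norm 𝕜 s hε).biUnion fun n _ =>
          (finite_setOf_le_norm 𝕜 (r n) hε).image _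
      refine h1.subset fun k hk => ?_
      rw [Set.mem_ofPred_eq] at hk
      refine Set.mem_iUnion₂.2 ⟨k.unpair.1, ?_, k.unpair.2, hk, Nat.pair_unpair k⟩
      have h3 : s k.unpair.1 = ((‖r k.unpair.1‖ : ℝ) : 𝕜) := hrs _
      rw [Set.mem_ofPred_eq, h3, RCLike.norm_ofReal, abs_norm]
      exact hk.trans (hn _ _)
    exact ⟨x, fun n m => by rw [hcoord, hcoord, hx, Nat.unpair_pair]⟩

end CZero

end

theorem mainTheorem2 {𝕜 : Type*} [RCLike 𝕜]
    {Z : Type*} [NormedAddCommGroup Z] [NormedSpace 𝕜 Z] [CompleteSpace Z]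
    [TopologicalSpace.SeparableSpace Z] :
    (∀ (X : Type*) [NormedAddCommGroup X] [NormedSpace 𝕜 X] [CompleteSpace X]
        (Y : Type*) [NormedAddCommGroup Y] [NormedSpace 𝕜 Y] [CompleteSpace Y],
        ContainsComplementedBigSum 𝕜 Z X Y → EveryEpsIsThreshold 𝕜 Z) ∧
    (ContainsComplementedCopy 𝕜 Z (ZeroAtInftyContinuousMap ℕ 𝕜) →
        ContainsComplementedBigSum 𝕜 Z
          (ZeroAtInftyContinuousMap ℕ 𝕜) (ZeroAtInftyContinuousMap ℕ 𝕜) ∧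
        EveryEpsIsThreshold 𝕜 Z) ∧
    (∀ (p : ENNReal) [Fact (1 ≤ p)], p ≠ ⊤ →
        ContainsComplementedCopy 𝕜 Z (lp (fun _ : ℕ => 𝕜) p) →
        ContainsComplementedBigSum 𝕜 Z
          (lp (fun _ : ℕ => 𝕜) p) (lp (fun _ : ℕ => 𝕜) p) ∧
        EveryEpsIsThreshold 𝕜 Z) :=
  ⟨fun _ _ _ _ _ _ _ _ h => h.everyEpsIsThreshold,
    fun h =>
      have h' := (isSelfSummingBasis_zeroAtInftyBasis 𝕜).containsComplementedBigSum h
      ⟨h', h'.everyEpsIsThreshold⟩,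
    fun _ _ hp h =>
      have h' := (isSelfSummingBasis_lpBasis 𝕜 hp).containsComplementedBigSum h
      ⟨h', h'.everyEpsIsThreshold⟩⟩
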